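/- Let $\Phi: M_2(\mathbb C)\to M_2(\mathbb C)$ be a quantum channel, i.e. a completely positive linear map with $\Phi(\mathrm{Id})=\mathrm{Id}$, and fix a Kraus decomposition $\Phi(X)=\sum_{i=1}^k v_i^*Xv_i$ with $k\ge 1$. Let $\Phi^*$ be the trace dual of $\Phi$, defined by $\operatorname{tr}(\Phi^*(Y)X)=\operatorname{tr}(Y\Phi(X))$ for all $X,Y\in M_2(\mathbb C)$. Assume that $\Phi$ is primitive: there is $n\ge 1$ such that $\Phi^n(X)$ is positive definite for every non-zero positive semi-definite $X\in M_2(\mathbb C)$. For $u$ in the group $U(k)$ of unitary $k\times k$ matrices put $v(u)=\sum_{j=1}^k u_{1j}v_j$, and let $\mu=\mu_{\mathrm{unif}}$ be the Haar measure on $U(k)$ normalized by $\mu(U(k))=k$. For $\hat x$ in the projective space $\mathrm P(\mathbb C^2)$ let $x$ denote a representative of norm $1$; for $w\in M_2(\mathbb C)$ let $w\cdot\hat x$ be the class of $wx$ if $wx\ne 0$, and an arbitrary point otherwise. Let $\Pi$ be the Markov kernel on $\mathrm P(\mathbb C^2)$ given by $$\Pi f(\hat x)=\int_{U(k)} f(v(u)\cdot\hat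 x)\,\|v(u)x\|^2\,d\mu(u),$$ and let $\nu_{\mathrm{unif}}$ be the unique probability measure on $\mathrm P(\mathbb C^2)$ that is invariant under the action of $U(2)$. Then $\Pi$ has a unique invariant probability measure $\nu_{\mathrm{inv}}$, and $\nu_{\mathrm{inv}}$ is equivalent to $\nu_{\mathrm{unif}}$, i.e. $\nu_{\mathrm{inv}}\ll\nu_{\mathrm{unif}}$ and $\nu_{\mathrm{unif}}\ll\nu_{\mathrm{inv}}$. Moreover $\Phi^*(|x'\rangle\langle x'|)$ is invertible for $\nu_{\mathrm{unif}}$-almost every $\hat x'$, and the density $f_{\mathrm{inv}}=\frac{d\nu_{\mathrm{inv}}}{d\nu_{\mathrm{unif}}}$ satisfies, for $\nu_{\mathrm{unif}}$-almost every $\hat x\in\mathrm P(\mathbb C^2)$, $$f_{\mathrm{inv}}(\hat x)=\int_{\mathrm P(\mathbb C^2)}\frac{2}{\det\Phi^*(|x'\rangle\langle x'|)}\,\big\langle x,\Phi^*(|x'\rangle\langle x'|)^{-1}x\big\rangle^{-3}f_{\mathrm{inv}}(\hat x')\,d\nu_{\mathrm{unif}}(\hat x').$$ -/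

import Mathlib

open MeasureTheory
open scoped ENNReal ComplexOrder

namespace QTraj

/-! ### Quantum channels -/

/-- The algebra `M_d(ℂ)` of complex `d × d` matrices. -/
abbrev Mat (d : ℕ) : Type := Matrix (Fin d) (Fin d) ℂ

/-- The map `Φ ⊗ id` on `M_d(ℂ) ⊗ M_n(ℂ)`, whose elements are matrices indexed by pairs:
`Φ` is applied to each of the `n × n` blocks of size `d × d`. -/
def ampliation {d : ℕ} (Φ : Mat d →ₗ[ℂ] Mat d) (n : ℕ)
    (M : Matrix (Fin d × Fin n) (Fin d × Fin n) ℂ) :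
    Matrix (Fin d × Fin n) (Fin d × Fin n) ℂ :=
  Matrix.of fun p q => Φ (Matrix.of fun i j => M (i, p.2) (j, q.2)) p.1 q.1

/-- A quantum channel (Heisenberg picture): a completely positive, unit preserving linear map. -/
structure IsQuantumChannel {d : ℕ} (Φ : Mat d →ₗ[ℂ] Mat d) : Prop where
  completely_positive : ∀ (n : ℕ) (M : Matrix (Fin d × Fin n) (Fin d × Fin n) ℂ),
    M.PosSemidef → (ampliation Φ n M).PosSemidef
  map_one : Φ 1 = 1

/-- `(v_i)_{i=1}^k` is a Kraus decomposition of `Φ`, i.e. `Φ(X) = ∑ i, v_i^* X v_i`. -/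
def IsKraus {d k : ℕ} (v : Fin k → Mat d) (Φ : Mat d →ₗ[ℂ] Mat d) : Prop :=
  ∀ X : Mat d, Φ X = ∑ i, (v i).conjTranspose * X * v i

/-- `Φ` is primitive: some fixed power `Φ^n`, `n ≥ 1`, maps every non-zero positive semi-definite
matrix to a positive definite one. -/
def IsPrimitive {d : ℕ} (Φ : Mat d →ₗ[ℂ] Mat d) : Prop :=
  ∃ n : ℕ, 1 ≤ n ∧ ∀ X : Mat d, X.PosSemidef → X ≠ 0 → ((⇑Φ)^[n] X).PosDef

/-- The trace dual `Φ^*` of `Φ`: its `(i, j)` entry at `Y` is `tr (Y Φ(E_{ji}))`, where `E_{ji}`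
is the matrix unit. See `trace_traceDual_mul` for the defining property. -/
def traceDual {d : ℕ} (Φ : Mat d →ₗ[ℂ] Mat d) (Y : Mat d) : Mat d :=
  Matrix.of fun i j => (Y * Φ (Matrix.single j i 1)).trace

/-- `tr (Φ^*(Y) X) = tr (Y Φ(X))`. -/
theorem trace_traceDual_mul {d : ℕ} (Φ : Mat d →ₗ[ℂ] Mat d) (Y X : Mat d) :
    (traceDual Φ Y * X).trace = (Y * Φ X).trace := by
  conv_rhs => rw [Matrix.matrix_eq_sum_single X]
  simp only [map_sum, Finset.mul_sum, Matrix.trace_sum]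
  rw [Finset.sum_comm]
  simp only [Matrix.trace, Matrix.diag_apply, Matrix.mul_apply (M := traceDual Φ Y)]
  refine Finset.sum_congr rfl fun i _ => Finset.sum_congr rfl fun j _ => ?_
  have h : Matrix.single j i (X j i) = X j i • Matrix.single j i (1 : ℂ) := by
    simp [Matrix.smul_single]
  rw [h, map_smul, Matrix.mul_smul]
  change _ = Matrix.trace (X j i • (Y * Φ (Matrix.single j i 1)))
  rw [Matrix.trace_smul, smul_eq_mul, mul_comm]
  rfl

/-! ### Haar measure on the unitary group -/

/-- The compact Lie group `U(k)` of unitary `k × k` matrices. -/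
abbrev U (k : ℕ) : Type := ↥(Matrix.unitaryGroup (Fin k) ℂ)

noncomputable instance instMeasurableSpaceU (k : ℕ) : MeasurableSpace (U k) := borel _

instance instBorelSpaceU (k : ℕ) : BorelSpace (U k) := ⟨rfl⟩

instance instCompactSpaceU (k : ℕ) : CompactSpace (U k) := by
  refine isCompact_iff_compactSpace.mp ?_
  have hK : IsCompact (Set.pi Set.univ fun _ : Fin k => Set.pi Set.univ fun _ : Fin k =>
      Metric.closedBall (0 : ℂ) 1) :=
    isCompact_univ_pi fun _ => isCompact_univ_pi fun _ => isCompact_closedBall 0 1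
  refine hK.of_isClosed_subset ?_ ?_
  · have h : ((Matrix.unitaryGroup (Fin k) ℂ : Submonoid (Mat k)) : Set (Mat k))
        = {A | star A * A = 1} := by
      ext A
      exact Matrix.mem_unitaryGroup_iff'
    rw [h]
    exact isClosed_eq (by fun_prop) continuous_const
  · intro A hA i _ j _
    simpa using entry_norm_bound_of_unitary hA i j

/-- The Haar probability measure on `U(k)`. -/
noncomputable def haarProb (k : ℕ) : Measure (U k) := Measure.haarMeasure ⊤

/-- The uniform measure `μ_unif` on `U(k)`: the Haar measure, with the normalization
`μ_unif(U(k)) = k`. -/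
noncomputable def muUnif (k : ℕ) : Measure (U k) := (k : ℝ≥0∞) • haarProb k

/-! ### The projective space -/

/-- `ℂ^d` with its Hermitian inner product. -/
abbrev Vec (d : ℕ) : Type := EuclideanSpace ℂ (Fin d)

/-- The projective space `P(ℂ^d)`. -/
abbrev PC (d : ℕ) : Type := Projectivization ℂ (Vec d)

/-- The quotient topology of `ℂ^d ∖ {0}`. -/
noncomputable instance instTopologicalSpacePC (d : ℕ) : TopologicalSpace (PC d) :=
  TopologicalSpace.coinduced
    (fun x : {x : Vec d // x ≠ 0} => Projectivization.mk ℂ x.1 x.2) inferInstance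

noncomputable instance instMeasurableSpacePC (d : ℕ) : MeasurableSpace (PC d) := borel _

instance instBorelSpacePC (d : ℕ) : BorelSpace (PC d) := ⟨rfl⟩

/-- A representative of norm one of a point of the projective space. Everything below depends on
it only through quantities that do not depend on its phase. -/
noncomputable def unitRep {d : ℕ} (x : PC d) : Vec d := ((‖x.rep‖⁻¹ : ℝ) : ℂ) • x.rep

theorem norm_unitRep {d : ℕ} (x : PC d) : ‖unitRep x‖ = 1 := by
  have h : ‖x.rep‖ ≠ 0 := norm_ne_zero_iff.mpr x.rep_nonzero
  rw [unitRep, norm_smul, Complex.norm_real, norm_inv, norm_norm, inv_mul_cancel₀ h]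

theorem unitRep_ne_zero {d : ℕ} (x : PC d) : unitRep x ≠ 0 := by
  intro h
  simpa [h] using norm_unitRep x

theorem mk_unitRep {d : ℕ} (x : PC d) : Projectivization.mk ℂ (unitRep x) (unitRep_ne_zero x) = x := by
  conv_rhs => rw [← Projectivization.mk_rep x]
  exact (Projectivization.mk_eq_mk_iff' ℂ _ _ _ _).mpr ⟨_, rfl⟩

open Classical in
/-- `w · x̂`, the class of `w x`. If `w x = 0`, the value is an arbitrary one, here `x̂`. -/
noncomputable def act {d : ℕ} (w : Mat d) (x : PC d) : PC d :=
  if h : Matrix.toEuclideanLin w (unitRep x) = 0 then x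
  else Projectivization.mk ℂ (Matrix.toEuclideanLin w (unitRep x)) h

/-- The class of the first vector of the canonical basis of `ℂ^d`. -/
noncomputable def basePoint (d : ℕ) [NeZero d] : PC d :=
  Projectivization.mk ℂ (EuclideanSpace.single (0 : Fin d) (1 : ℂ)) (by simp)

/-- The uniform probability measure `ν_unif` on `P(ℂ^d)`, i.e. the unique probability measure
that is invariant under the action of `U(d)`: the law of `u · x̂₀` for a Haar distributed
`u` in `U(d)`. -/
noncomputable def nuUnif (d : ℕ) [NeZero d] : Measure (PC d) :=
  (haarProb d).map fun u : U d => act (u : Mat d) (basePoint d)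

/-! ### Quantum trajectories -/

/-- `v(u) = v_1(u) = ∑ j, u_{1j} v_j`. -/
def krausAt {d k : ℕ} [NeZero k] (v : Fin k → Mat d) (u : U k) : Mat d :=
  ∑ j, (u : Mat k) 0 j • v j

/-- The transition operator of the quantum trajectory driven by the measure `μ` on `U(k)`,
`Π f(x̂) = ∫ f(v(u) · x̂) ‖v(u) x‖² dμ(u)`, on functions with values in `[0, ∞]`. -/
noncomputable def transition {d k : ℕ} [NeZero k] (v : Fin k → Mat d) (μ : Measure (U k))
    (f : PC d → ℝ≥0∞) (x : PC d) : ℝ≥0∞ :=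
  ∫⁻ u, f (act (krausAt v u) x) *
    ENNReal.ofReal (‖Matrix.toEuclideanLin (krausAt v u) (unitRep x)‖ ^ 2) ∂μ

/-- `ν` is invariant for `Π`: `ν Π = ν`, i.e. `∫ Π(x̂, A) dν(x̂) = ν(A)` for every Borel set `A`,
where `Π(x̂, A) = Π 1_A (x̂)`. -/
def IsInvariantMeasure {d k : ℕ} [NeZero k] (v : Fin k → Mat d) (μ : Measure (U k))
    (ν : Measure (PC d)) : Prop :=
  ∀ A : Set (PC d), MeasurableSet A → ∫⁻ x, transition v μ (A.indicator 1) x ∂ν = ν A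

/-! ### The integral kernel -/

/-- The rank-one orthogonal projector `|x⟩⟨x|`. -/
noncomputable def ketBra {d : ℕ} (x : PC d) : Mat d :=
  Matrix.of fun i j => unitRep x i * star (unitRep x j)

/-- The integral kernel `2 / det Φ^*(|x'⟩⟨x'|) · ⟨x, Φ^*(|x'⟩⟨x'|)⁻¹ x⟩⁻³` in dimension two.
The determinant and the scalar product are real, as `Φ^*(|x'⟩⟨x'|)` is Hermitian. -/
noncomputable def gapKernel (Φ : Mat 2 →ₗ[ℂ] Mat 2) (x' x : PC 2) : ℝ :=
  2 / (traceDual Φ (ketBra x')).det.re *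
    ((inner ℂ (unitRep x)
      (Matrix.toEuclideanLin (traceDual Φ (ketBra x'))⁻¹ (unitRep x))).re) ^ (-3 : ℤ)

end QTraj

/-! Fix `x` and let `A` be the matrix with columns `v_j x`. Then `v(u)x = A a`, where `a` is the
first row of `u`, uniform on the unit sphere of `ℂ^k`. Since `F(z) = ‖z‖² f(ẑ)` is homogeneous of
degree two and a standard complex Gaussian `z` in `ℂ^k` has mean square norm `k`, `Πf(x̂)` is the
Gaussian mean of `F(Az)`. The law of `Az` depends only on the covariance `A Aᴴ = Φ^*(|x⟩⟨x|)`. When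
this is invertible, a square factor `L` may replace `A`, and a linear change of variables with polar
coordinates yields the kernel of the theorem (`transition_eq_lintegral_gapKernel`). The singular
points form a null set: they lie in the zero set of a minor of `A`, a quadratic form in `x` that
factors into linear forms.

Existence. `Φ^*(|x'⟩⟨x'|)` has trace one, so its adjugate is `1 - Φ^*(|x'⟩⟨x'|)`, and the kernel is
`2 det² (1 - overlap)⁻³ ≥ 2 det²` with `det = det Φ^*(|x'⟩⟨x'|)`. This is a minorization by `s ⊗
ν_unif` with `s = 2 det²`. An invariant density is then the Neumann series of the residual kernel `K
- s` applied to `1`; its convergence is the content of the Lyapunov inequality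
(`exists_kerOp_eq_self`, `exists_lyapunov`). Primitivity enters here: were `s` to vanish along all
trajectories for `n` steps, `Φ^{*n}` would send a pure state to a multiple of a pure state.
Compactness of the sphere makes the positivity uniform.

Uniqueness. The kernel is positive almost everywhere, so two invariant densities coincide
(`ae_eq_of_kerOp_ae_eq`). That an arbitrary invariant measure has a density is a separate matter,
since singular points do not move absolutely continuously. If a null set `B` is reached in `n` steps
from `x`, the path must start at a singular point and run through singular points until its last
jump, and from each of them the jump is deterministic. Hence `Φ^{*n}(|x⟩⟨x|)` is a multiple of a
pure state, which primitivity forbids (`IsInvariantMeasure.absolutelyContinuous`). -/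

namespace QTraj

/-! ### Positive integral kernels: existence and uniqueness of invariant densities -/

section PositiveKernel

variable {X : Type*} [MeasurableSpace X] {ν : Measure X}

/-- The action of an integral kernel on densities. -/
noncomputable def kerOp (ν : Measure X) (K : X → X → ℝ≥0∞) (f : X → ℝ≥0∞) (y : X) : ℝ≥0∞ :=
  ∫⁻ x, K x y * f x ∂ν

theorem measurable_kerOp [SFinite ν] {K : X → X → ℝ≥0∞} (hK : Measurable (Function.uncurry K))
    {f : X → ℝ≥0∞} (hf : Measurable f) : Measurable (kerOp ν K f) := by
  unfold kerOp
  refine Measurable.lintegral_prod_left' (f := fun p : X × X => K p.1 p.2 * f p.1) ?_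
  exact hK.mul (hf.comp measurable_fst)

theorem measurable_mul_left {K : X → X → ℝ≥0∞} (hK : Measurable (Function.uncurry K))
    {V : X → ℝ≥0∞} (hV : Measurable V) (x : X) : Measurable fun y => K x y * V y :=
  (hK.of_uncurry_left).mul hV

theorem measurable_mul_right {K : X → X → ℝ≥0∞} (hK : Measurable (Function.uncurry K))
    {f : X → ℝ≥0∞} (hf : Measurable f) (y : X) : Measurable fun x => K x y * f x :=
  (hK.of_uncurry_right).mul hf

theorem lintegral_kerOp_mul [SFinite ν] {K : X → X → ℝ≥0∞} (hK : Measurable (Function.uncurry K))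
    {f V : X → ℝ≥0∞} (hf : Measurable f) (hV : Measurable V) :
    ∫⁻ y, kerOp ν K f y * V y ∂ν = ∫⁻ x, f x * ∫⁻ y, K x y * V y ∂ν ∂ν := by
  have h1 : ∀ y, kerOp ν K f y * V y = ∫⁻ x, K x y * f x * V y ∂ν := fun y => by
    rw [lintegral_mul_const _ (measurable_mul_right hK hf _)]; rfl
  simp_rw [h1]
  rw [lintegral_lintegral_swap (by
    exact ((hK.comp measurable_swap).mul (hf.comp measurable_snd)).mul
      (hV.comp measurable_fst) |>.aemeasurable)]
  refine lintegral_congr fun x => ?_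
  rw [← lintegral_const_mul _ (measurable_mul_left hK hV _)]
  exact lintegral_congr fun y => by ring

theorem lintegral_kerOp [SFinite ν] {K : X → X → ℝ≥0∞} (hK : Measurable (Function.uncurry K))
    (hK1 : ∀ᵐ x ∂ν, ∫⁻ y, K x y ∂ν = 1) {f : X → ℝ≥0∞} (hf : Measurable f) :
    ∫⁻ y, kerOp ν K f y ∂ν = ∫⁻ x, f x ∂ν := by
  have := lintegral_kerOp_mul (ν := ν) hK hf (V := fun _ => 1) measurable_const
  simp only [mul_one] at this
  rw [this]
  refine lintegral_congr_ae ?_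
  filter_upwards [hK1] with x hx
  rw [hx, mul_one]

/-- A Markov kernel with a minorization `s ⊗ ν` and a Lyapunov function has an invariant density. -/
theorem exists_kerOp_eq_self [IsProbabilityMeasure ν] {K : X → X → ℝ≥0∞}
    (hK : Measurable (Function.uncurry K)) (hK1 : ∀ᵐ x ∂ν, ∫⁻ y, K x y ∂ν = 1)
    {s : X → ℝ≥0∞} (hs : Measurable s) (hsf : ∀ x, s x ≠ ∞) (hsK : ∀ᵐ x ∂ν, ∀ y, s x ≤ K x y)
    {V : X → ℝ≥0∞} (hV : Measurable V) (hVf : ∫⁻ x, V x ∂ν ≠ ∞)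
    (hLyap : ∀ᵐ x ∂ν, ∫⁻ y, K x y * V y ∂ν + 1 ≤ V x + s x * ∫⁻ y, V y ∂ν) :
    ∃ g : X → ℝ≥0∞, Measurable g ∧ kerOp ν K g = g ∧ ∫⁻ x, g x ∂ν ≠ ∞ ∧ ∫⁻ x, g x ∂ν ≠ 0 := by
  -- The residual kernel left after removing the minorization. The truncated subtraction is a true
  -- one almost everywhere, by `hsK`.
  set R : X → X → ℝ≥0∞ := fun x y => K x y - s x with hR
  have hRm : Measurable (Function.uncurry R) := hK.sub (hs.comp measurable_fst)
  set a : ℕ → X → ℝ≥0∞ := fun n => (kerOp ν R)^[n] (fun _ => 1) with ha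
  have ha0 : a 0 = fun _ => 1 := rfl
  have has : ∀ n, a (n + 1) = kerOp ν R (a n) := fun n => by
    simp only [ha, Function.iterate_succ', Function.comp]
  have ham : ∀ n, Measurable (a n) := by
    intro n
    induction n with
    | zero => exact measurable_const
    | succ n ih => rw [has]; exact measurable_kerOp hRm ih
  -- The term `s x * ∫ V` in the Lyapunov bound is exactly the contribution of the minorization, so
  -- `R` has a pure drift of one. Telescoping it bounds the total mass of the iterates `a n` by `∫
  -- V`.
  have hRV : ∀ᵐ x ∂ν, ∫⁻ y, R x y * V y ∂ν + 1 ≤ V x := by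
    filter_upwards [hsK, hLyap] with x h1 h2
    have h3 : ∫⁻ y, K x y * V y ∂ν = ∫⁻ y, R x y * V y ∂ν + s x * ∫⁻ y, V y ∂ν := by
      rw [← lintegral_const_mul _ hV, ← lintegral_add_left (measurable_mul_left hRm hV _)]
      refine lintegral_congr fun y => ?_
      rw [← add_mul, hR, tsub_add_cancel_of_le (h1 y)]
    rw [h3, add_right_comm] at h2
    exact (ENNReal.add_le_add_iff_right (ENNReal.mul_ne_top (hsf x) hVf)).1 h2
  have hstep : ∀ n, ∫⁻ x, a (n + 1) x * V x ∂ν + ∫⁻ x, a n x ∂ν ≤ ∫⁻ x, a n x * V x ∂ν := by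
    intro n
    rw [has, lintegral_kerOp_mul hRm (ham n) hV, ← lintegral_add_right _ (ham n)]
    refine lintegral_mono_ae ?_
    filter_upwards [hRV] with x hx
    calc a n x * ∫⁻ y, R x y * V y ∂ν + a n x = a n x * (∫⁻ y, R x y * V y ∂ν + 1) := by ring
      _ ≤ _ := by gcongr
  have hsum : ∀ n, ∑ j ∈ Finset.range n, ∫⁻ x, a j x ∂ν + ∫⁻ x, a n x * V x ∂ν
      ≤ ∫⁻ x, V x ∂ν := by
    intro n
    induction n with
    | zero => simp [ha0]
    | succ n ih =>
      refine le_trans ?_ ih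
      rw [Finset.sum_range_succ, add_assoc, add_comm (∫⁻ x, a n x ∂ν)]
      gcongr
      exact hstep n
  set g : X → ℝ≥0∞ := fun x => ∑' n, a n x with hg
  have hgm : Measurable g := Measurable.tsum ham
  have hgi : ∫⁻ x, g x ∂ν = ∑' n, ∫⁻ x, a n x ∂ν :=
    lintegral_tsum fun n => (ham n).aemeasurable
  have hgf : ∫⁻ x, g x ∂ν ≠ ∞ := by
    refine ne_top_of_le_ne_top hVf ?_
    rw [hgi, ENNReal.tsum_eq_iSup_nat]
    exact iSup_le fun n => le_trans le_self_add (hsum n)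
  have hRg : ∀ y, 1 + kerOp ν R g y = g y := by
    intro y
    have h1 : kerOp ν R g y = ∑' n, a (n + 1) y := by
      simp only [kerOp, hg, ← ENNReal.tsum_mul_left]
      rw [lintegral_tsum fun n => (measurable_mul_right hRm (ham n) _).aemeasurable]
      exact tsum_congr fun n => by rw [has]; rfl
    rw [h1, hg]
    exact (tsum_eq_zero_add' (f := fun n => a n y) ENNReal.summable).symm
  have hKg : ∀ y, kerOp ν K g y = kerOp ν R g y + ∫⁻ x, s x * g x ∂ν := by
    intro y
    simp only [kerOp]
    rw [← lintegral_add_right _ (show Measurable fun x => s x * g x from hs.mul hgm)]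
    refine lintegral_congr_ae ?_
    filter_upwards [hsK] with x hx
    rw [← add_mul, hR, tsub_add_cancel_of_le (hx y)]
  -- `g = 1 + Rg` and `Kg = Rg + ∫ s g`, while `K` preserves mass; comparing integrals gives the
  -- constant, and then `Kg = g`.
  have hc : ∫⁻ x, s x * g x ∂ν = 1 := by
    have h1 := lintegral_kerOp hK hK1 hgm
    simp_rw [hKg] at h1
    have h2 : ∫⁻ y, (1 + kerOp ν R g y) ∂ν = ∫⁻ x, g x ∂ν := lintegral_congr hRg
    rw [← h2, lintegral_add_right _ measurable_const, lintegral_add_left measurable_const,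
      add_comm] at h1
    have h3 : ∫⁻ y, kerOp ν R g y ∂ν ≠ ∞ :=
      ne_top_of_le_ne_top hgf (lintegral_mono fun y => by rw [← hRg y]; exact le_add_self)
    simpa using (ENNReal.add_left_inj h3).1 h1
  refine ⟨g, hgm, ?_, hgf, ?_⟩
  · funext y
    rw [hKg, hc, add_comm, hRg]
  · have : (1 : ℝ≥0∞) ≤ ∫⁻ x, g x ∂ν := by
      calc (1 : ℝ≥0∞) = ∫⁻ _, 1 ∂ν := by simp
        _ ≤ _ := lintegral_mono fun y => by rw [← hRg y]; exact le_self_add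
    intro h
    simp [h] at this

/-- An integral operator with an almost everywhere positive kernel is positivity improving. -/
theorem kerOp_ne_zero {K : X → X → ℝ≥0∞} (hK : Measurable (Function.uncurry K))
    (hpos : ∀ᵐ x ∂ν, ∀ y, K x y ≠ 0) {f : X → ℝ≥0∞} (hf : Measurable f)
    (hf0 : ∫⁻ x, f x ∂ν ≠ 0) (y : X) : kerOp ν K f y ≠ 0 := by
  intro h
  rw [kerOp, lintegral_eq_zero_iff (measurable_mul_right hK hf _)] at h
  refine hf0 ((lintegral_eq_zero_iff hf).2 ?_)
  filter_upwards [h, hpos] with x h1 h2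
  simpa [h2 y] using h1

/-- Invariant densities of a positive Markov kernel are unique. -/
theorem ae_eq_of_kerOp_ae_eq [SFinite ν] {K : X → X → ℝ≥0∞} (hK : Measurable (Function.uncurry K))
    (hK1 : ∀ᵐ x ∂ν, ∫⁻ y, K x y ∂ν = 1) (hpos : ∀ᵐ x ∂ν, ∀ y, K x y ≠ 0)
    {f g : X → ℝ≥0∞} (hf : Measurable f) (hg : Measurable g) (hfi : ∫⁻ x, f x ∂ν = 1)
    (hgi : ∫⁻ x, g x ∂ν = 1) (hTf : kerOp ν K f =ᵐ[ν] f) (hTg : kerOp ν K g =ᵐ[ν] g) :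
    f =ᵐ[ν] g := by
  -- `Km ≤ m` and mass preservation force `Km = m`. So `f - m` and `g - m` are invariant of equal
  -- mass, and at each point one of them is zero; a nonzero one would be positive almost everywhere.
  set m : X → ℝ≥0∞ := fun x => min (f x) (g x) with hm
  have hmm : Measurable m := hf.min hg
  have hmi : ∫⁻ x, m x ∂ν ≠ ∞ := by
    refine ne_top_of_le_ne_top ENNReal.one_ne_top (hfi ▸ lintegral_mono fun x => min_le_left _ _)
  have hTm_le : kerOp ν K m ≤ᵐ[ν] m := by
    filter_upwards [hTf, hTg] with y h1 h2
    refine le_min ?_ ?_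
    · rw [← h1]; exact lintegral_mono fun x => by gcongr; exact min_le_left _ _
    · rw [← h2]; exact lintegral_mono fun x => by gcongr; exact min_le_right _ _
  have hTm : kerOp ν K m =ᵐ[ν] m := by
    refine ae_eq_of_ae_le_of_lintegral_le hTm_le ?_ hmm.aemeasurable ?_
    · rwa [lintegral_kerOp hK hK1 hmm]
    · rw [lintegral_kerOp hK hK1 hmm]
  have hrest : ∀ {h : X → ℝ≥0∞}, Measurable h → (∀ x, m x ≤ h x) → ∫⁻ x, h x ∂ν = 1 →
      kerOp ν K h =ᵐ[ν] h → ∫⁻ x, (h x - m x) ∂ν = 1 - ∫⁻ x, m x ∂ν ∧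
        kerOp ν K (fun x => h x - m x) =ᵐ[ν] fun x => h x - m x := by
    intro h hh hmh hhi hTh
    refine ⟨by rw [lintegral_sub hmm hmi (ae_of_all _ hmh), hhi], ?_⟩
    filter_upwards [hTh, hTm, ae_lt_top hmm hmi] with y h1 h2 h3
    rw [← h1]
    refine ENNReal.eq_sub_of_add_eq h3.ne ?_
    conv_lhs => rw [← h2]
    simp only [kerOp]
    rw [← lintegral_add_right _ (measurable_mul_right hK hmm _)]
    exact lintegral_congr fun x => by rw [← mul_add, tsub_add_cancel_of_le (hmh x)]
  have hfm : Measurable fun x => f x - m x := hf.sub hmm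
  have hgm : Measurable fun x => g x - m x := hg.sub hmm
  obtain ⟨hf1, hf2⟩ := hrest hf (fun x => min_le_left _ _) hfi hTf
  obtain ⟨hg1, hg2⟩ := hrest hg (fun x => min_le_right _ _) hgi hTg
  have hf0 : ∫⁻ x, (f x - m x) ∂ν = 0 := by
    by_contra h0
    have h1 := kerOp_ne_zero hK hpos hfm h0
    have : ∫⁻ x, (g x - m x) ∂ν = 0 := by
      rw [lintegral_eq_zero_iff hgm]
      filter_upwards [hf2] with x hx
      have h2 : f x - m x ≠ 0 := hx ▸ h1 x
      have h3 : g x ≤ f x := by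
        by_contra h4
        exact h2 (by simp [hm, min_eq_left (not_le.1 h4).le])
      simp [hm, min_eq_right h3]
    exact h0 (by rw [hf1, ← hg1, this])
  have hg0 : ∫⁻ x, (g x - m x) ∂ν = 0 := by rw [hg1, ← hf1, hf0]
  rw [lintegral_eq_zero_iff hfm] at hf0
  rw [lintegral_eq_zero_iff hgm] at hg0
  filter_upwards [hf0, hg0] with x h1 h2
  have h3 : f x ≤ m x := tsub_eq_zero_iff_le.1 h1
  have h4 : g x ≤ m x := tsub_eq_zero_iff_le.1 h2
  exact le_antisymm (h3.trans (min_le_right _ _)) (h4.trans (min_le_left _ _))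

end PositiveKernel

/-! ### Complex Gaussian vectors -/

section Gaussian

theorem finrank_real_vec (d : ℕ) : Module.finrank ℝ (Vec d) = 2 * d := by
  rw [← Module.finrank_mul_finrank ℝ ℂ (Vec d)]
  simp

theorem real_inner_vec {d : ℕ} (x y : Vec d) : (inner ℝ x y : ℝ) = (inner ℂ x y).re := by
  simp only [PiLp.inner_apply, Complex.re_sum]
  exact Finset.sum_congr rfl fun i _ => real_inner_eq_re_inner ℂ (x i) (y i)

theorem integral_exp_neg_norm_sq (d : ℕ) {b : ℝ} (hb : 0 < b) :
    ∫ z : Vec d, Real.exp (-b * ‖z‖ ^ 2) = (Real.pi / b) ^ d := by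
  rw [GaussianFourier.integral_rexp_neg_mul_sq_norm hb, finrank_real_vec]
  rw [← Real.rpow_natCast]
  congr 1
  push_cast
  ring

/-- In polar coordinates this integral and the plain Gaussian one share the unit ball volume as a
factor, so their ratio is a ratio of Gamma values, namely `d / b`. -/
theorem integral_norm_sq_mul_exp_neg_norm_sq (d : ℕ) [NeZero d] {b : ℝ} (hb : 0 < b) :
    ∫ z : Vec d, ‖z‖ ^ 2 * Real.exp (-b * ‖z‖ ^ 2) = d * Real.pi ^ d / b ^ (d + 1) := by
  have hd : 0 < d := Nat.pos_of_ne_zero (NeZero.ne d)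
  have key : ∀ n : ℕ, ∫ y in Set.Ioi (0 : ℝ), y ^ (2 * n + 1) * Real.exp (-b * y ^ 2)
      = b ^ (-((n : ℝ) + 1)) * (1 / 2) * Real.Gamma (n + 1) := by
    intro n
    have h := integral_rpow_mul_exp_neg_mul_rpow (p := 2) (q := 2 * n + 1) (b := b) (by norm_num)
      (by have : (0 : ℝ) ≤ n := Nat.cast_nonneg n
          linarith) hb
    have e1 : -(2 * (n : ℝ) + 1 + 1) / 2 = -(n + 1) := by ring
    have e1' : (2 * (n : ℝ) + 1 + 1) / 2 = n + 1 := by ring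
    rw [e1, e1'] at h
    rw [← h]
    refine setIntegral_congr_fun measurableSet_Ioi fun y hy => ?_
    have e2 : (2 * (n : ℝ) + 1) = ((2 * n + 1 : ℕ) : ℝ) := by push_cast; ring
    simp only [e2, Real.rpow_natCast]
    norm_num
  obtain ⟨n, rfl⟩ : ∃ n, d = n + 1 := ⟨d - 1, by omega⟩
  have h1 := integral_fun_norm_addHaar (volume : Measure (Vec (n + 1)))
    (fun y => Real.exp (-b * y ^ 2))
  have h2 := integral_fun_norm_addHaar (volume : Measure (Vec (n + 1)))
    (fun y => y ^ 2 * Real.exp (-b * y ^ 2))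
  rw [integral_exp_neg_norm_sq _ hb] at h1
  rw [h2]
  have e1 : ∀ y : ℝ, y ^ (Module.finrank ℝ (Vec (n + 1)) - 1) • Real.exp (-b * y ^ 2) =
      y ^ (2 * n + 1) * Real.exp (-b * y ^ 2) := fun y => by
    rw [finrank_real_vec, smul_eq_mul]; congr 2
  have e2 : ∀ y : ℝ, y ^ (Module.finrank ℝ (Vec (n + 1)) - 1) • (y ^ 2 * Real.exp (-b * y ^ 2)) =
      y ^ (2 * (n + 1) + 1) * Real.exp (-b * y ^ 2) := fun y => by
    rw [finrank_real_vec, smul_eq_mul, ← mul_assoc, ← pow_add]; congr 2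
  simp_rw [e1] at h1
  simp_rw [e2]
  rw [key] at h1 ⊢
  set κ : ℝ := (volume : Measure (Vec (n + 1))).real (Metric.ball 0 1)
  have e3 : b ^ (-((((n + 1 : ℕ)) : ℝ) + 1)) = b ^ (-((n : ℝ) + 1)) * b⁻¹ := by
    rw [← Real.rpow_neg_one b, ← Real.rpow_add hb]; congr 1; push_cast; ring
  have e4 : Real.Gamma (((n + 1 : ℕ) : ℝ) + 1) = (n + 1 : ℕ) * Real.Gamma (n + 1) := by
    rw [Real.Gamma_add_one (by positivity)]
    push_cast
    rfl
  rw [e3, e4]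
  simp only [nsmul_eq_mul, smul_eq_mul] at h1 ⊢
  have : ((n + 1 : ℕ) : ℝ) * Real.pi ^ (n + 1) / b ^ (n + 1 + 1)
      = (n + 1 : ℕ) * b⁻¹ * (Real.pi / b) ^ (n + 1) := by
    rw [div_pow, pow_succ b (n + 1)]; field_simp
  rw [this, h1]
  ring

theorem lintegral_norm_sq_mul_exp_neg_norm_sq (d : ℕ) [NeZero d] {b : ℝ} (hb : 0 < b) :
    ∫⁻ z : Vec d, ENNReal.ofReal (‖z‖ ^ 2 * Real.exp (-b * ‖z‖ ^ 2)) =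
      ENNReal.ofReal (d * Real.pi ^ d / b ^ (d + 1)) := by
  have hd : (0 : ℝ) < d := by exact_mod_cast Nat.pos_of_ne_zero (NeZero.ne d)
  have h := integral_norm_sq_mul_exp_neg_norm_sq d hb
  rw [← h, ofReal_integral_eq_lintegral_ofReal]
  -- A non-integrable function has integral zero by convention, whereas the computed value is
  -- positive.
  · by_contra hi
    rw [integral_undef hi] at h
    have : 0 < d * Real.pi ^ d / b ^ (d + 1) := by positivity
    exact this.ne h
  · exact ae_of_all _ fun z => by positivity

/-- The density of the standard complex Gaussian vector. -/
noncomputable def gaussDensity (d : ℕ) (z : Vec d) : ℝ :=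
  (Real.pi ^ d)⁻¹ * Real.exp (-‖z‖ ^ 2)

theorem gaussDensity_nonneg (d : ℕ) (z : Vec d) : 0 ≤ gaussDensity d z := by
  unfold gaussDensity; positivity

theorem measurable_gaussDensity (d : ℕ) : Measurable (gaussDensity d) := by
  unfold gaussDensity; fun_prop

/-- The law of the standard complex Gaussian vector. -/
noncomputable def gauss (d : ℕ) : Measure (Vec d) :=
  volume.withDensity fun z => ENNReal.ofReal (gaussDensity d z)

theorem integrable_gaussDensity (d : ℕ) : Integrable (gaussDensity d) := by
  have h := integral_exp_neg_norm_sq d one_pos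
  refine Integrable.const_mul ?_ _
  by_contra hi
  simp only [neg_one_mul] at h
  rw [integral_undef hi] at h
  have : 0 < (Real.pi / 1) ^ d := by positivity
  exact this.ne h

instance isFiniteMeasure_gauss (d : ℕ) : IsFiniteMeasure (gauss d) :=
  isFiniteMeasure_withDensity_ofReal (integrable_gaussDensity d).2

theorem charFun_gauss (d : ℕ) (t : Vec d) :
    charFun (gauss d) t = Complex.exp (-(‖t‖ ^ 2 / 4 : ℝ)) := by
  rw [charFun_apply, gauss, integral_withDensity_eq_integral_toReal_smul
    (measurable_gaussDensity d).ennreal_ofReal (ae_of_all _ fun _ => ENNReal.ofReal_lt_top)]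
  have h := GaussianFourier.integral_cexp_neg_mul_sq_norm_add (V := Vec d) (b := 1) (by simp)
    Complex.I t
  have e : ∀ z : Vec d, (ENNReal.ofReal (gaussDensity d z)).toReal •
      Complex.exp ((inner ℝ z t : ℝ) * Complex.I) = ((Real.pi ^ d)⁻¹ : ℝ) *
        Complex.exp (-1 * (‖z‖ : ℂ) ^ 2 + Complex.I * (inner ℝ t z : ℝ)) := fun z => by
    rw [ENNReal.toReal_ofReal (gaussDensity_nonneg d z), gaussDensity, Complex.exp_add,
      real_inner_comm, Complex.real_smul]
    push_cast
    rw [mul_comm Complex.I, neg_one_mul]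
    ring
  simp_rw [e]
  rw [integral_const_mul, h, finrank_real_vec]
  have e2 : ((2 * d : ℕ) : ℂ) / 2 = d := by push_cast; ring
  rw [e2, Complex.cpow_natCast]
  have hpi : (Real.pi : ℂ) ≠ 0 := by exact_mod_cast Real.pi_ne_zero
  push_cast
  rw [← mul_assoc, div_one, inv_mul_cancel₀ (pow_ne_zero _ hpi), one_mul, Complex.I_sq]
  congr 1
  ring

/-- The adjoint moves `A` onto `t`, and `‖Aᴴ t‖² = ⟨t, A Aᴴ t⟩`; only the covariance survives. -/
theorem charFun_map_toEuclideanLin {m n : ℕ} (A : Matrix (Fin m) (Fin n) ℂ) (t : Vec m) :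
    charFun ((gauss n).map (Matrix.toEuclideanLin A)) t =
      Complex.exp (-((inner ℂ t (Matrix.toEuclideanLin (A * A.conjTranspose) t)).re / 4 : ℝ)) := by
  have hA : Measurable (Matrix.toEuclideanLin A) :=
    (LinearMap.continuous_of_finiteDimensional _).measurable
  rw [charFun_apply, integral_map hA.aemeasurable (by fun_prop)]
  have e : ∀ z : Vec n, (inner ℝ (Matrix.toEuclideanLin A z) t : ℝ) =
      inner ℝ z (Matrix.toEuclideanLin A.conjTranspose t) := fun z => by
    rw [real_inner_vec, real_inner_vec,
      Matrix.toEuclideanLin_conjTranspose_eq_adjoint, LinearMap.adjoint_inner_right]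
  simp_rw [e]
  rw [← charFun_apply, charFun_gauss]
  congr 4
  rw [← inner_self_eq_norm_sq (𝕜 := ℂ)]
  conv_lhs => rw [Matrix.toEuclideanLin_conjTranspose_eq_adjoint, LinearMap.adjoint_inner_left,
    ← Matrix.toEuclideanLin_conjTranspose_eq_adjoint]
  simp [Matrix.toLpLin_apply]

/-- This allows a `2 × k` matrix to be traded for a square one, which admits a change of variables.
-/
theorem gauss_map_eq_of_mul_conjTranspose_eq {m n l : ℕ} {A : Matrix (Fin m) (Fin n) ℂ}
    {L : Matrix (Fin m) (Fin l) ℂ} (h : A * A.conjTranspose = L * L.conjTranspose) :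
    (gauss n).map (Matrix.toEuclideanLin A) = (gauss l).map (Matrix.toEuclideanLin L) := by
  refine Measure.ext_of_charFun ?_
  funext t
  rw [charFun_map_toEuclideanLin, charFun_map_toEuclideanLin, h]

/-- The real determinant of a complex linear map is the squared modulus of its complex determinant.
-/
theorem volume_map_toEuclideanLin {d : ℕ} {L : Mat d} (hL : L.det ≠ 0) :
    (volume : Measure (Vec d)).map (Matrix.toEuclideanLin L) =
      ENNReal.ofReal ((‖L.det‖ ^ 2)⁻¹) • volume := by
  have hdet : LinearMap.det ((Matrix.toEuclideanLin L).restrictScalars ℝ) = ‖L.det‖ ^ 2 := by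
    rw [LinearMap.det_restrictScalars, Algebra.norm_complex_apply, Complex.normSq_eq_norm_sq]
    congr 2
    simp
  have h := Measure.map_linearMap_addHaar_eq_smul_addHaar (volume : Measure (Vec d))
    (f := (Matrix.toEuclideanLin L).restrictScalars ℝ) (by rw [hdet]; simpa using hL)
  rw [hdet, abs_of_nonneg (by positivity)] at h
  exact h

end Gaussian

/-! ### Haar unitaries, polar coordinates, and the size-biased direction of a Gaussian -/

section Haar

instance instIsHaarMeasureHaarProb (k : ℕ) : (haarProb k).IsHaarMeasure := by
  unfold haarProb; infer_instance

instance instIsProbabilityMeasureHaarProb (k : ℕ) : IsProbabilityMeasure (haarProb k) :=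
  ⟨Measure.haarMeasure_self (K₀ := (⊤ : TopologicalSpace.PositiveCompacts (U k)))⟩

/-- Unimodularity of a compact group: a right translate is again a Haar probability measure. -/
instance instIsMulRightInvariantHaarProb (k : ℕ) : (haarProb k).IsMulRightInvariant := by
  refine ⟨fun g => ?_⟩
  have h1 : ((haarProb k).map (· * g)).IsHaarMeasure := inferInstance
  have h2 : IsProbabilityMeasure ((haarProb k).map (· * g)) :=
    Measure.isProbabilityMeasure_map (by fun_prop)
  exact Measure.isHaarMeasure_eq_of_isProbabilityMeasure _ _

theorem measurable_entry {k : ℕ} (i j : Fin k) : Measurable fun u : U k => (u : Mat k) i j := by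
  have h : Continuous fun u : U k => (u : Mat k) := continuous_subtype_val
  exact (h.matrix_elem i j).measurable

theorem norm_toEuclideanLin_unitary {d : ℕ} {u : Mat d} (hu : u ∈ Matrix.unitaryGroup (Fin d) ℂ)
    (z : Vec d) : ‖Matrix.toEuclideanLin u z‖ = ‖z‖ := by
  have h : ‖Matrix.toEuclideanLin u z‖ ^ 2 = ‖z‖ ^ 2 := by
    rw [← inner_self_eq_norm_sq (𝕜 := ℂ), ← inner_self_eq_norm_sq (𝕜 := ℂ)]
    have h1 : inner ℂ (Matrix.toEuclideanLin u z) (Matrix.toEuclideanLin u z) = inner ℂ z z := by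
      rw [← LinearMap.adjoint_inner_left, ← Matrix.toEuclideanLin_conjTranspose_eq_adjoint]
      have h2 : u.conjTranspose * u = 1 := Matrix.mem_unitaryGroup_iff'.1 hu
      congr 1
      simp [Matrix.toLpLin_apply, h2]
    rw [h1]
  exact (sq_eq_sq₀ (norm_nonneg _) (norm_nonneg _)).1 h

theorem measurePreserving_unitary {d : ℕ} {u : Mat d} (hu : u ∈ Matrix.unitaryGroup (Fin d) ℂ) :
    MeasurePreserving (Matrix.toEuclideanLin u : Vec d → Vec d) := by
  let f : Vec d →ₗᵢ[ℝ] Vec d :=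
    { (Matrix.toEuclideanLin u).restrictScalars ℝ with
      norm_map' := norm_toEuclideanLin_unitary hu }
  exact (f.toLinearIsometryEquiv rfl).measurePreserving

theorem transpose_mem_unitaryGroup {d : ℕ} {u : Mat d}
    (hu : u ∈ Matrix.unitaryGroup (Fin d) ℂ) : u.transpose ∈ Matrix.unitaryGroup (Fin d) ℂ := by
  rw [Matrix.mem_unitaryGroup_iff'] at hu
  have h : star u.transpose = (star u).transpose := rfl
  rw [Matrix.mem_unitaryGroup_iff, h, ← Matrix.transpose_mul, hu, Matrix.transpose_one]

/-- The first vector of the canonical basis. -/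
noncomputable def e₀ (d : ℕ) [NeZero d] : Vec d := EuclideanSpace.single (0 : Fin d) (1 : ℂ)

theorem exists_unitary_smul_eq {d : ℕ} [NeZero d] (z : Vec d) :
    ∃ g : U d, z = (‖z‖ : ℂ) • Matrix.toEuclideanLin (g : Mat d) (e₀ d) := by
  by_cases hz : z = 0
  · exact ⟨1, by simp [hz]⟩
  have hz' : (‖z‖ : ℂ) ≠ 0 := by simpa using hz
  set w : Vec d := (‖z‖ : ℂ)⁻¹ • z with hw
  have hw1 : ‖w‖ = 1 := by
    rw [hw, norm_smul]; simp [hz]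
  obtain ⟨b, hb⟩ := Orthonormal.exists_orthonormalBasis_extension_of_card_eq (𝕜 := ℂ) (E := Vec d)
    (ι := Fin d) (by simp) (v := fun _ => w) (s := {0})
    ⟨fun _ => hw1, fun i j hij => absurd (Subsingleton.elim i j) hij⟩
  have hb0 : b 0 = w := hb 0 rfl
  refine ⟨⟨(EuclideanSpace.basisFun (Fin d) ℂ).toBasis.toMatrix b,
    OrthonormalBasis.toMatrix_orthonormalBasis_mem_unitary _ _⟩, ?_⟩
  have h1 : Matrix.toEuclideanLin ((EuclideanSpace.basisFun (Fin d) ℂ).toBasis.toMatrix b) (e₀ d)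
      = w := by
    ext i
    simp [e₀, Matrix.toLpLin_apply, Module.Basis.toMatrix_apply, hb0]
  rw [h1, hw, smul_inv_smul₀ hz']

/-- Average the invariance under `T` over `G`, exchange the integrals, replace `T` by `S`, which has
the same law at each point, and exchange back. In use, `T` rotates `z` and `S` sends it to a random
point of the sphere of radius `‖z‖`. -/
theorem lintegral_eq_lintegral_average {G E : Type*} [MeasurableSpace G] [MeasurableSpace E]
    {η : Measure G} [IsProbabilityMeasure η] {m : Measure E} [SFinite m] {T S : G → E → E}
    (hT : Measurable (Function.uncurry T)) (hTm : ∀ g, MeasurePreserving (T g) m m)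
    (hS : Measurable (Function.uncurry S))
    (hTS : ∀ (z : E) (Ψ : E → ℝ≥0∞), Measurable Ψ → ∫⁻ g, Ψ (T g z) ∂η = ∫⁻ g, Ψ (S g z) ∂η)
    {Ψ : E → ℝ≥0∞} (hΨ : Measurable Ψ) :
    ∫⁻ z, Ψ z ∂m = ∫⁻ g, ∫⁻ z, Ψ (S g z) ∂m ∂η := by
  calc ∫⁻ z, Ψ z ∂m = ∫⁻ g, ∫⁻ z, Ψ (T g z) ∂m ∂η := by
        simp_rw [fun g => (hTm g).lintegral_comp hΨ]
        simp
    _ = ∫⁻ z, ∫⁻ g, Ψ (T g z) ∂η ∂m := lintegral_lintegral_swap (f := fun g z => Ψ (T g z))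
        (hΨ.comp hT).aemeasurable
    _ = ∫⁻ z, ∫⁻ g, Ψ (S g z) ∂η ∂m := lintegral_congr fun z => hTS z Ψ hΨ
    _ = _ := (lintegral_lintegral_swap (f := fun g z => Ψ (S g z))
        (hΨ.comp hS).aemeasurable).symm

theorem measurable_toEuclideanLin_comp {X : Type*} [MeasurableSpace X] {m n : ℕ}
    {A : X → Matrix (Fin m) (Fin n) ℂ} (hA : ∀ i j, Measurable fun x => A x i j)
    {z : X → Vec n} (hz : Measurable z) :
    Measurable fun x => Matrix.toEuclideanLin (A x) (z x) := by
  refine (WithLp.measurable_toLp 2 _).comp (measurable_pi_iff.2 fun i => ?_)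
  change Measurable fun x => ∑ j, A x i j * z x j
  have hz' : ∀ j, Measurable fun x => z x j := fun j =>
    (measurable_pi_apply j).comp ((WithLp.measurable_ofLp 2 _).comp hz)
  exact Finset.measurable_sum _ fun j _ => (hA i j).mul (hz' j)

theorem toEuclideanLin_mul_apply {m n l : ℕ} (A : Matrix (Fin m) (Fin n) ℂ)
    (B : Matrix (Fin n) (Fin l) ℂ) (z : Vec l) :
    Matrix.toEuclideanLin (A * B) z = Matrix.toEuclideanLin A (Matrix.toEuclideanLin B z) := by
  simp [Matrix.toLpLin_apply]

/-- Polar decomposition of the volume: the first column of a Haar unitary is uniform on the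
sphere. -/
theorem lintegral_eq_lintegral_col {d : ℕ} [NeZero d] {Ψ : Vec d → ℝ≥0∞} (hΨ : Measurable Ψ) :
    ∫⁻ z, Ψ z = ∫⁻ u : U d, (∫⁻ z : Vec d,
      Ψ ((‖z‖ : ℂ) • Matrix.toEuclideanLin (u : Mat d) (e₀ d))) ∂(haarProb d) := by
  refine lintegral_eq_lintegral_average (T := fun (u : U d) z => Matrix.toEuclideanLin (u : Mat d) z)
    (S := fun (u : U d) z => (‖z‖ : ℂ) • Matrix.toEuclideanLin (u : Mat d) (e₀ d)) ?_
    (fun u => measurePreserving_unitary u.2) ?_ (fun z Ψ hΨ => ?_) hΨ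
  · exact measurable_toEuclideanLin_comp
      (fun i j => (measurable_entry i j).comp measurable_fst) measurable_snd
  · refine Measurable.smul (f := fun p : U d × Vec d => (‖p.2‖ : ℂ)) (by fun_prop) ?_
    exact measurable_toEuclideanLin_comp
      (fun i j => (measurable_entry i j).comp measurable_fst) measurable_const
  · obtain ⟨g, hg⟩ := exists_unitary_smul_eq z
    rw [← lintegral_mul_right_eq_self (μ := haarProb d)
      (fun u : U d => Ψ ((‖z‖ : ℂ) • Matrix.toEuclideanLin (u : Mat d) (e₀ d))) g]
    refine lintegral_congr fun u => ?_
    conv_lhs => rw [hg]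
    simp only [map_smul, Submonoid.coe_mul, toEuclideanLin_mul_apply]

/-- The first row of a Haar unitary is uniform on the sphere. -/
theorem lintegral_eq_lintegral_row {d : ℕ} [NeZero d] {Ψ : Vec d → ℝ≥0∞} (hΨ : Measurable Ψ) :
    ∫⁻ z, Ψ z = ∫⁻ u : U d, (∫⁻ z : Vec d,
      Ψ ((‖z‖ : ℂ) • Matrix.toEuclideanLin (u : Mat d).transpose (e₀ d))) ∂(haarProb d) := by
  refine lintegral_eq_lintegral_average
    (T := fun (u : U d) z => Matrix.toEuclideanLin (u : Mat d).transpose z)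
    (S := fun (u : U d) z => (‖z‖ : ℂ) • Matrix.toEuclideanLin (u : Mat d).transpose (e₀ d)) ?_
    (fun u => measurePreserving_unitary (transpose_mem_unitaryGroup u.2)) ?_
    (fun z Ψ hΨ => ?_) hΨ
  · exact measurable_toEuclideanLin_comp
      (fun i j => (measurable_entry j i).comp measurable_fst) measurable_snd
  · refine Measurable.smul (f := fun p : U d × Vec d => (‖p.2‖ : ℂ)) (by fun_prop) ?_
    exact measurable_toEuclideanLin_comp
      (fun i j => (measurable_entry j i).comp measurable_fst) measurable_const
  · obtain ⟨g, hg⟩ := exists_unitary_smul_eq z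
    -- The left translation is by the transpose of `g` because `(gᵀ u)ᵀ = uᵀ g`.
    rw [← lintegral_mul_left_eq_self (μ := haarProb d)
      (fun u : U d => Ψ ((‖z‖ : ℂ) • Matrix.toEuclideanLin (u : Mat d).transpose (e₀ d)))
      ⟨(g : Mat d).transpose, transpose_mem_unitaryGroup g.2⟩]
    refine lintegral_congr fun u => ?_
    conv_lhs => rw [hg]
    simp only [map_smul, Submonoid.coe_mul, toEuclideanLin_mul_apply, Matrix.transpose_mul,
      Matrix.transpose_transpose]

/-- `F` is homogeneous of degree two. -/
def IsHomogSq {d : ℕ} (F : Vec d → ℝ≥0∞) : Prop :=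
  ∀ (c : ℂ) (z : Vec d), F (c • z) = ENNReal.ofReal (‖c‖ ^ 2) * F z

/-- Homogeneity splits off the radial integral `E‖z‖² = d`, which is precisely the mass given to
`muUnif`. -/
theorem lintegral_gauss_eq_row {d : ℕ} [NeZero d] {F : Vec d → ℝ≥0∞} (hF : Measurable F)
    (hh : IsHomogSq F) :
    ∫⁻ z, F z ∂(gauss d) =
      d * ∫⁻ u : U d, F (Matrix.toEuclideanLin (u : Mat d).transpose (e₀ d)) ∂(haarProb d) := by
  have hd : Measurable fun z : Vec d => ENNReal.ofReal (gaussDensity d z) :=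
    (measurable_gaussDensity d).ennreal_ofReal
  have hn : ∀ (u : U d) (z : Vec d),
      ‖(‖z‖ : ℂ) • Matrix.toEuclideanLin (u : Mat d).transpose (e₀ d)‖ = ‖z‖ := fun u z => by
    rw [norm_smul, norm_toEuclideanLin_unitary (transpose_mem_unitaryGroup u.2)]
    simp [e₀]
  rw [gauss, lintegral_withDensity_eq_lintegral_mul _ hd hF, lintegral_eq_lintegral_row (hd.mul hF)]
  rw [← lintegral_const_mul' _ _ (ENNReal.natCast_ne_top d)]
  refine lintegral_congr fun u => ?_
  have h1 : ∀ z : Vec d, ((fun z => ENNReal.ofReal (gaussDensity d z)) * F)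
      ((‖z‖ : ℂ) • Matrix.toEuclideanLin (u : Mat d).transpose (e₀ d)) =
      ENNReal.ofReal ((Real.pi ^ d)⁻¹) *
        ENNReal.ofReal (‖z‖ ^ 2 * Real.exp (-1 * ‖z‖ ^ 2)) *
        F (Matrix.toEuclideanLin (u : Mat d).transpose (e₀ d)) := fun z => by
    rw [Pi.mul_apply, hh, gaussDensity, hn, ← mul_assoc, ← ENNReal.ofReal_mul (by positivity),
      ← ENNReal.ofReal_mul (by positivity)]
    congr 2
    rw [Complex.norm_real, norm_norm, neg_one_mul]
    ring
  simp_rw [h1]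
  rw [lintegral_mul_const _ (by fun_prop), lintegral_const_mul _ (by fun_prop),
    lintegral_norm_sq_mul_exp_neg_norm_sq d one_pos, ← ENNReal.ofReal_mul (by positivity)]
  congr 1
  rw [← ENNReal.ofReal_natCast]
  congr 1
  have := Real.pi_pos
  field_simp
  simp

/-- The law of the direction of a Gaussian vector with covariance `L Lᴴ`, size-biased. -/
theorem lintegral_gauss_comp_eq_col {L : Mat 2} (hL : L.det ≠ 0) {F : Vec 2 → ℝ≥0∞}
    (hF : Measurable F) (hh : IsHomogSq F) :
    ∫⁻ z, F (Matrix.toEuclideanLin L z) ∂(gauss 2) =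
      ∫⁻ u : U 2, ENNReal.ofReal (2 * (‖L.det‖ ^ 2)⁻¹ *
        ((‖Matrix.toEuclideanLin L⁻¹ (Matrix.toEuclideanLin (u : Mat 2) (e₀ 2))‖ ^ 2) ^ 3)⁻¹) *
        F (Matrix.toEuclideanLin (u : Mat 2) (e₀ 2)) ∂(haarProb 2) := by
  have hd : Measurable fun z : Vec 2 => ENNReal.ofReal (gaussDensity 2 z) :=
    (measurable_gaussDensity 2).ennreal_ofReal
  have hlin : ∀ A : Mat 2, Measurable (Matrix.toEuclideanLin A : Vec 2 → Vec 2) := fun A =>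
    (LinearMap.continuous_of_finiteDimensional _).measurable
  have hinv : ∀ z, Matrix.toEuclideanLin L⁻¹ (Matrix.toEuclideanLin L z) = z := fun z => by
    rw [← toEuclideanLin_mul_apply, Matrix.nonsing_inv_mul _ (isUnit_iff_ne_zero.2 hL)]
    simp
  have hinv' : ∀ z, Matrix.toEuclideanLin L (Matrix.toEuclideanLin L⁻¹ z) = z := fun z => by
    rw [← toEuclideanLin_mul_apply, Matrix.mul_nonsing_inv _ (isUnit_iff_ne_zero.2 hL)]
    simp
  have hG : Measurable fun z : Vec 2 =>
      ENNReal.ofReal (gaussDensity 2 (Matrix.toEuclideanLin L⁻¹ z)) * F z :=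
    (hd.comp (hlin _)).mul hF
  rw [gauss, lintegral_withDensity_eq_lintegral_mul _ hd
    (show Measurable fun z => F (Matrix.toEuclideanLin L z) from hF.comp (hlin L))]
  have h0 : ∀ z, ((fun z => ENNReal.ofReal (gaussDensity 2 z)) *
      fun z => F (Matrix.toEuclideanLin L z)) z =
      (fun z : Vec 2 => ENNReal.ofReal (gaussDensity 2 (Matrix.toEuclideanLin L⁻¹ z)) * F z)
        (Matrix.toEuclideanLin L z) := fun z => by
    simp only [Pi.mul_apply, hinv]
  -- Substitute `Lz` for `z` first, at the cost of `‖det L‖⁻²`, and only then pass to polar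
  -- coordinates.
  rw [lintegral_congr h0, ← lintegral_map hG (hlin L), volume_map_toEuclideanLin hL,
    lintegral_smul_measure, lintegral_eq_lintegral_col hG, smul_eq_mul,
    ← lintegral_const_mul' _ _ ENNReal.ofReal_ne_top]
  refine lintegral_congr fun u => ?_
  set w := Matrix.toEuclideanLin (u : Mat 2) (e₀ 2) with hw
  have hw0 : Matrix.toEuclideanLin L⁻¹ w ≠ 0 := by
    intro h
    have h1 := hinv' w
    rw [h, map_zero] at h1
    have h2 : ‖w‖ = 1 := by
      rw [hw, norm_toEuclideanLin_unitary u.2]; simp [e₀]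
    rw [← h1] at h2
    simp at h2
  -- On the ray through `w` the Gaussian exponent is `-q r²`, so the second moment formula with `b =
  -- q` gives `2π² / q³`; this is the origin of the exponent `-3`.
  set q : ℝ := ‖Matrix.toEuclideanLin L⁻¹ w‖ ^ 2 with hq
  have hq0 : 0 < q := by positivity
  have h1 : ∀ z : Vec 2, ENNReal.ofReal (gaussDensity 2
      (Matrix.toEuclideanLin L⁻¹ ((‖z‖ : ℂ) • w))) * F ((‖z‖ : ℂ) • w) =
      ENNReal.ofReal ((Real.pi ^ 2)⁻¹) *
        ENNReal.ofReal (‖z‖ ^ 2 * Real.exp (-q * ‖z‖ ^ 2)) * F w := fun z => by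
    rw [hh, gaussDensity, ← mul_assoc, ← ENNReal.ofReal_mul (by positivity),
      ← ENNReal.ofReal_mul (by positivity)]
    congr 2
    rw [map_smul, norm_smul, Complex.norm_real, norm_norm, mul_pow, ← hq,
      show -(‖z‖ ^ 2 * q) = -q * ‖z‖ ^ 2 by ring]
    ring
  simp_rw [h1]
  rw [lintegral_mul_const _ (by fun_prop), lintegral_const_mul _ (by fun_prop),
    lintegral_norm_sq_mul_exp_neg_norm_sq 2 hq0, ← ENNReal.ofReal_mul (by positivity),
    ← mul_assoc, ← ENNReal.ofReal_mul (by positivity)]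
  congr 2
  have := Real.pi_pos
  push_cast
  field_simp

end Haar

/-! ### Projective space: homogeneous lifts and measurability -/

section ProjectiveSpace

variable {d : ℕ}

open Classical in
/-- The class of a vector in the projective space; the class of `0` is the base point. -/
noncomputable def proj [NeZero d] (w : Vec d) : PC d :=
  if h : w ≠ 0 then Projectivization.mk ℂ w h else basePoint d

theorem continuous_mk_PC :
    Continuous fun x : {x : Vec d // x ≠ 0} => Projectivization.mk ℂ x.1 x.2 :=
  continuous_coinduced_rng

theorem measurable_proj [NeZero d] : Measurable (proj : Vec d → PC d) := by
  classical
  have h := Measurable.dite (s := {w : Vec d | w ≠ 0})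
    (f := fun x => Projectivization.mk ℂ x.1 x.2) (g := fun _ => basePoint d)
    continuous_mk_PC.measurable measurable_const (measurableSet_singleton 0).compl
  convert h using 1
  funext w
  by_cases hw : w = 0 <;> simp [proj, hw]

theorem proj_of_ne_zero [NeZero d] {w : Vec d} (h : w ≠ 0) :
    proj w = Projectivization.mk ℂ w h := by
  simp [proj, h]

theorem proj_smul [NeZero d] {c : ℂ} (hc : c ≠ 0) (w : Vec d) : proj (c • w) = proj w := by
  by_cases hw : w = 0
  · simp [hw]
  · rw [proj_of_ne_zero hw, proj_of_ne_zero (smul_ne_zero hc hw)]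
    exact (Projectivization.mk_eq_mk_iff' ℂ _ _ _ _).mpr ⟨c, rfl⟩

theorem exists_unitRep_proj_eq [NeZero d] {w : Vec d} (hw : w ≠ 0) :
    ∃ c : ℂ, ‖c‖ * ‖w‖ = 1 ∧ unitRep (proj w) = c • w := by
  have h := mk_unitRep (proj w)
  conv_rhs at h => rw [proj_of_ne_zero hw]
  obtain ⟨c, hc⟩ := (Projectivization.mk_eq_mk_iff' ℂ _ _ _ _).mp h
  exact ⟨c, by rw [← norm_smul, hc, norm_unitRep], hc.symm⟩

theorem act_eq_proj [NeZero d] {w : Mat d} {x : PC d}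
    (h : Matrix.toEuclideanLin w (unitRep x) ≠ 0) :
    act w x = proj (Matrix.toEuclideanLin w (unitRep x)) := by
  rw [act, dif_neg h, proj_of_ne_zero h]

/-- The extension of a function on the projective space to a homogeneous function of degree two. -/
noncomputable def homog [NeZero d] (f : PC d → ℝ≥0∞) (z : Vec d) : ℝ≥0∞ :=
  ENNReal.ofReal (‖z‖ ^ 2) * f (proj z)

theorem measurable_homog [NeZero d] {f : PC d → ℝ≥0∞} (hf : Measurable f) :
    Measurable (homog f) := by
  unfold homog
  exact Measurable.mul (by fun_prop) (hf.comp measurable_proj)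

theorem isHomogSq_homog [NeZero d] (f : PC d → ℝ≥0∞) : IsHomogSq (homog f) := by
  intro c z
  by_cases hc : c = 0
  · simp [homog, hc]
  · rw [homog, homog, proj_smul hc, norm_smul, mul_pow, ENNReal.ofReal_mul (by positivity),
      mul_assoc]

theorem IsHomogSq.comp_toEuclideanLin {m n : ℕ} {F : Vec m → ℝ≥0∞} (hF : IsHomogSq F)
    (A : Matrix (Fin m) (Fin n) ℂ) : IsHomogSq fun z => F (Matrix.toEuclideanLin A z) :=
  fun c z => by simp only [map_smul, hF c]

/-- The weight `‖v(u)x‖²` vanishes exactly where `act` takes its default value, so the arbitrary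
choice disappears. -/
theorem transition_eq_lintegral_homog {k : ℕ} [NeZero d] [NeZero k] (v : Fin k → Mat d)
    (μ : Measure (U k)) (f : PC d → ℝ≥0∞) (x : PC d) :
    transition v μ f x =
      ∫⁻ u, homog f (Matrix.toEuclideanLin (krausAt v u) (unitRep x)) ∂μ := by
  refine lintegral_congr fun u => ?_
  by_cases h : Matrix.toEuclideanLin (krausAt v u) (unitRep x) = 0
  · simp [h, homog]
  · rw [homog, act_eq_proj h, mul_comm]

/-- The rank one matrix `|z⟩⟨z|`. -/
def outer (z : Vec d) : Mat d := Matrix.of fun i j => z i * star (z j)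

theorem ketBra_eq_outer (x : PC d) : ketBra x = outer (unitRep x) := rfl

theorem outer_smul (c : ℂ) (z : Vec d) : outer (c • z) = ((‖c‖ : ℂ) ^ 2) • outer z := by
  ext i j
  simp only [outer, Matrix.of_apply, PiLp.smul_apply, smul_eq_mul, star_mul', Matrix.smul_apply,
    ← Complex.mul_conj', Complex.star_def]
  ring

theorem ketBra_proj [NeZero d] {w : Vec d} (hw : w ≠ 0) :
    ketBra (proj w) = ((‖w‖⁻¹ : ℝ) : ℂ) ^ 2 • outer w := by
  obtain ⟨c, hc, hcw⟩ := exists_unitRep_proj_eq hw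
  rw [ketBra_eq_outer, hcw, outer_smul, eq_inv_of_mul_eq_one_left hc]

/-- `unitRep` is a choice with no regularity, but the projector is free of the phase and hence
continuous for the quotient topology. -/
theorem measurable_ketBra [NeZero d] (i j : Fin d) : Measurable fun x : PC d => ketBra x i j := by
  refine Continuous.measurable (continuous_coinduced_dom.2 ?_)
  have h : ((fun x : PC d => ketBra x i j) ∘
      fun x : {x : Vec d // x ≠ 0} => Projectivization.mk ℂ x.1 x.2) =
      fun x : {x : Vec d // x ≠ 0} => ((‖x.1‖⁻¹ : ℝ) : ℂ) ^ 2 * (x.1 i * star (x.1 j)) := by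
    funext x
    have := ketBra_proj x.2
    rw [proj_of_ne_zero x.2] at this
    simp only [Function.comp, this]
    rfl
  rw [h]
  have h1 : Continuous fun x : {x : Vec d // x ≠ 0} => ‖x.1‖⁻¹ :=
    Continuous.inv₀ (by fun_prop) fun x => norm_ne_zero_iff.2 x.2
  have h2 : ∀ l, Continuous fun x : {x : Vec d // x ≠ 0} => x.1 l := fun l => by fun_prop
  exact ((Complex.continuous_ofReal.comp h1).pow 2).mul ((h2 i).mul (continuous_star.comp (h2 j)))

/-- Column `j` of `|x⟩⟨x|` is the conjugate of `x_j` times `x`; divided by `|x_j|`, the square root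
of a diagonal entry, it is `x` up to a phase. One of the two columns is nonzero. -/
theorem exists_measurable_section :
    ∃ σ : PC 2 → Vec 2, Measurable σ ∧ ∀ x, ∃ c : ℂ, ‖c‖ = 1 ∧ σ x = c • unitRep x := by
  classical
  let col : Fin 2 → PC 2 → Vec 2 := fun j x =>
    ((Real.sqrt (ketBra x j j).re : ℂ))⁻¹ • WithLp.toLp 2 fun i => ketBra x i j
  have hcol : ∀ j, Measurable (col j) := fun j => by
    refine Measurable.smul (f := fun x => ((Real.sqrt (ketBra x j j).re : ℂ))⁻¹) ?_ ?_
    · exact (Complex.measurable_ofReal.comp (Real.continuous_sqrt.measurable.comp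
        (Complex.measurable_re.comp (measurable_ketBra j j)))).inv
    · exact (WithLp.measurable_toLp 2 _).comp (measurable_pi_iff.2 fun i => measurable_ketBra i j)
  have hcol' : ∀ j x, unitRep x j ≠ 0 → ∃ c : ℂ, ‖c‖ = 1 ∧ col j x = c • unitRep x := by
    intro j x hj
    refine ⟨(‖unitRep x j‖ : ℂ)⁻¹ * star (unitRep x j), ?_, ?_⟩
    · rw [norm_mul, norm_inv, Complex.norm_real, norm_norm, norm_star, inv_mul_cancel₀]
      simpa using hj
    · have h1 : ketBra x j j = ((‖unitRep x j‖ ^ 2 : ℝ) : ℂ) := by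
        simp [ketBra, Complex.mul_conj']
      simp only [col, h1, Complex.ofReal_re, Real.sqrt_sq (norm_nonneg _)]
      ext i
      simp only [PiLp.smul_apply, smul_eq_mul, ketBra, Matrix.of_apply]
      ring
  refine ⟨fun x => if ketBra x 0 0 = 0 then col 1 x else col 0 x,
    Measurable.ite (measurableSet_eq_fun (measurable_ketBra 0 0) measurable_const)
      (hcol 1) (hcol 0), fun x => ?_⟩
  by_cases h : ketBra x 0 0 = 0
  · simp only [h, if_true]
    refine hcol' 1 x fun h1 => unitRep_ne_zero x ?_
    have h0 : unitRep x 0 = 0 := by simpa [ketBra] using h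
    ext i
    fin_cases i
    · exact h0
    · exact h1
  · simp only [h, if_false]
    refine hcol' 0 x fun h1 => h ?_
    simp [ketBra, h1]

theorem measurable_krausAt_apply {k : ℕ} [NeZero k] (v : Fin k → Mat d) {X : Type*}
    [MeasurableSpace X] {u : X → U k} (hu : Measurable u) {z : X → Vec d} (hz : Measurable z) :
    Measurable fun x => Matrix.toEuclideanLin (krausAt v (u x)) (z x) := by
  refine measurable_toEuclideanLin_comp (fun i j => ?_) hz
  simp only [krausAt, Matrix.sum_apply, Matrix.smul_apply, smul_eq_mul]
  exact Finset.measurable_sum _ fun l _ => ((measurable_entry 0 l).comp hu).mul measurable_const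

instance instIsFiniteMeasureMuUnif (k : ℕ) : IsFiniteMeasure (muUnif k) := by
  unfold muUnif
  exact Measure.smul_finite _ (ENNReal.natCast_ne_top k)

/-- A homogeneous function does not see phases, so the measurable section may replace `unitRep`. -/
theorem measurable_transition {k : ℕ} [NeZero k] (v : Fin k → Mat 2) {f : PC 2 → ℝ≥0∞}
    (hf : Measurable f) : Measurable (transition v (muUnif k) f) := by
  obtain ⟨σ, hσ, hσ'⟩ := exists_measurable_section
  have h : transition v (muUnif k) f = fun x =>
      ∫⁻ u, homog f (Matrix.toEuclideanLin (krausAt v u) (σ x)) ∂(muUnif k) := by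
    funext x
    rw [transition_eq_lintegral_homog]
    obtain ⟨c, hc, hcx⟩ := hσ' x
    refine lintegral_congr fun u => ?_
    rw [hcx, map_smul, isHomogSq_homog f c, hc]
    simp
  rw [h]
  exact Measurable.lintegral_prod_right' (f := fun p : PC 2 × U k =>
    homog f (Matrix.toEuclideanLin (krausAt v p.2) (σ p.1)))
    ((measurable_homog hf).comp (measurable_krausAt_apply v measurable_snd
      (hσ.comp measurable_fst)))

theorem act_unitary_basePoint [NeZero d] (u : U d) :
    act (u : Mat d) (basePoint d) = proj (Matrix.toEuclideanLin (u : Mat d) (e₀ d)) := by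
  have he : e₀ d ≠ 0 := by simp [e₀]
  have hb : basePoint d = proj (e₀ d) := (proj_of_ne_zero he).symm
  obtain ⟨c, hc, hce⟩ := exists_unitRep_proj_eq he
  have hc0 : c ≠ 0 := by rintro rfl; simp at hc
  have h : Matrix.toEuclideanLin (u : Mat d) (unitRep (basePoint d)) ≠ 0 := by
    rw [← norm_ne_zero_iff, norm_toEuclideanLin_unitary u.2, norm_unitRep]
    exact one_ne_zero
  rw [act_eq_proj h, hb, hce, map_smul, proj_smul hc0]

theorem measurable_proj_unitary [NeZero d] :
    Measurable fun u : U d => proj (Matrix.toEuclideanLin (u : Mat d) (e₀ d)) :=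
  measurable_proj.comp (measurable_toEuclideanLin_comp measurable_entry measurable_const)

theorem nuUnif_eq_map [NeZero d] : nuUnif d =
    (haarProb d).map fun u : U d => proj (Matrix.toEuclideanLin (u : Mat d) (e₀ d)) := by
  rw [nuUnif]
  congr 1
  funext u
  exact act_unitary_basePoint u

instance instIsProbabilityMeasureNuUnif [NeZero d] : IsProbabilityMeasure (nuUnif d) := by
  rw [nuUnif_eq_map]
  exact Measure.isProbabilityMeasure_map measurable_proj_unitary.aemeasurable

theorem lintegral_nuUnif [NeZero d] {f : PC d → ℝ≥0∞} (hf : Measurable f) :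
    ∫⁻ x, f x ∂(nuUnif d) =
      ∫⁻ u : U d, f (proj (Matrix.toEuclideanLin (u : Mat d) (e₀ d))) ∂(haarProb d) := by
  rw [nuUnif_eq_map, lintegral_map hf measurable_proj_unitary]

end ProjectiveSpace

/-! ### The matrix of columns `v_j z` and the trace dual -/

section KrausMatrix

variable {d k : ℕ} {Φ : Mat d →ₗ[ℂ] Mat d} {v : Fin k → Mat d}

/-- The matrix with columns `v_j z`. -/
noncomputable def krausMat (v : Fin k → Mat d) (z : Vec d) : Matrix (Fin d) (Fin k) ℂ :=
  Matrix.of fun i j => Matrix.toEuclideanLin (v j) z i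

/-- One step of the trajectory is a fixed linear image of the first row of `u`, which reduces
everything to a uniform vector on a sphere. -/
theorem toEuclideanLin_krausAt [NeZero k] (v : Fin k → Mat d) (u : U k) (z : Vec d) :
    Matrix.toEuclideanLin (krausAt v u) z =
      Matrix.toEuclideanLin (krausMat v z)
        (Matrix.toEuclideanLin (u : Mat k).transpose (e₀ k)) := by
  ext i
  simp only [krausAt, krausMat, map_sum, LinearMap.sum_apply, map_smul, LinearMap.smul_apply,
    WithLp.ofLp_sum, Finset.sum_apply, e₀, Matrix.toLpLin_apply, Matrix.mulVec, dotProduct,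
    Matrix.of_apply, Matrix.transpose_apply, WithLp.ofLp_smul, Pi.smul_apply, smul_eq_mul,
    PiLp.ofLp_single, Pi.single_apply, mul_ite, mul_one, mul_zero, Finset.sum_ite_eq',
    Finset.mem_univ, if_true]
  exact Finset.sum_congr rfl fun j _ => mul_comm _ _

theorem traceDual_eq_sum (hv : IsKraus v Φ) (Y : Mat d) :
    traceDual Φ Y = ∑ l, v l * Y * (v l).conjTranspose := by
  ext i j
  have h : ∀ B : Matrix (Fin d) (Fin d) ℂ, (B * Matrix.single j i 1).trace = B i j := fun B => by
    simp [Matrix.trace_mul_single]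
  rw [← h (∑ l, v l * Y * (v l).conjTranspose), traceDual, Matrix.of_apply, hv, Finset.mul_sum,
    Finset.sum_mul, Matrix.trace_sum, Matrix.trace_sum]
  refine Finset.sum_congr rfl fun l _ => ?_
  rw [Matrix.mul_assoc (v l), Matrix.mul_assoc (v l), Matrix.trace_mul_comm (v l)]
  simp only [Matrix.mul_assoc]

theorem mul_outer_mul_conjTranspose (A : Mat d) (z : Vec d) :
    A * outer z * A.conjTranspose = outer (Matrix.toEuclideanLin A z) := by
  ext i j
  simp only [outer, Matrix.mul_apply, Matrix.of_apply, Matrix.conjTranspose_apply,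
    Matrix.toLpLin_apply, Matrix.mulVec, dotProduct, star_sum, star_mul', Finset.sum_mul,
    Finset.mul_sum]
  exact Finset.sum_congr rfl fun a _ => Finset.sum_congr rfl fun b _ => by ring

theorem traceDual_outer_eq_sum (hv : IsKraus v Φ) (z : Vec d) :
    traceDual Φ (outer z) = ∑ l, outer (Matrix.toEuclideanLin (v l) z) := by
  rw [traceDual_eq_sum hv]
  exact Finset.sum_congr rfl fun l _ => mul_outer_mul_conjTranspose _ _

/-- Identifies the covariance of the Gaussian image with `Φ^*(|z⟩⟨z|)`. -/
theorem traceDual_outer (hv : IsKraus v Φ) (z : Vec d) :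
    traceDual Φ (outer z) = krausMat v z * (krausMat v z).conjTranspose := by
  rw [traceDual_outer_eq_sum hv]
  ext i j
  simp [Matrix.sum_apply, outer, krausMat, Matrix.mul_apply]

theorem inner_toEuclideanLin_eq_trace (B : Mat d) (z : Vec d) :
    inner ℂ z (Matrix.toEuclideanLin B z) = (B * outer z).trace := by
  simp only [PiLp.inner_apply, Matrix.trace, Matrix.diag_apply, Matrix.mul_apply, outer,
    Matrix.of_apply, Matrix.toLpLin_apply, Matrix.mulVec, dotProduct, RCLike.inner_apply,
    Finset.sum_mul]
  exact Finset.sum_congr rfl fun i _ => Finset.sum_congr rfl fun j _ => by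
    rw [Complex.star_def]; ring

theorem trace_outer (z : Vec d) : (outer z).trace = (‖z‖ : ℂ) ^ 2 := by
  rw [← Complex.ofReal_pow, EuclideanSpace.norm_sq_eq]
  push_cast
  exact Finset.sum_congr rfl fun i _ => Complex.mul_conj' (z i)

theorem trace_traceDual (h1 : Φ 1 = 1) (Y : Mat d) : (traceDual Φ Y).trace = Y.trace := by
  have h := trace_traceDual_mul Φ Y 1
  rwa [mul_one, h1, mul_one] at h

theorem trace_traceDual_ketBra (h1 : Φ 1 = 1) (x : PC d) :
    (traceDual Φ (ketBra x)).trace = 1 := by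
  rw [trace_traceDual h1, ketBra_eq_outer, trace_outer, norm_unitRep]
  simp

theorem traceDual_smul (c : ℂ) (Y : Mat d) : traceDual Φ (c • Y) = c • traceDual Φ Y := by
  ext i j
  simp [traceDual]

end KrausMatrix

/-! ### The integral kernel: closed form, lower bound, and relation to the transition operator -/

section Kernel

open MatrixOrder in
theorem exists_eq_conjTranspose_mul_self {m : ℕ} {M : Mat m} (hM : M.PosSemidef) :
    ∃ B : Mat m, M = B.conjTranspose * B :=
  CStarAlgebra.nonneg_iff_eq_star_mul_self.mp hM.nonneg

/-- A positive semi-definite matrix is `Bᴴ B`; with `L = Bᴴ`, the inverse covariance is `(L⁻¹)ᴴ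
L⁻¹`. -/
theorem exists_mul_conjTranspose_eq {m n : ℕ} (A : Matrix (Fin m) (Fin n) ℂ)
    (hA : (A * A.conjTranspose).det ≠ 0) :
    ∃ L : Mat m, A * A.conjTranspose = L * L.conjTranspose ∧ L.det ≠ 0 ∧
      (A * A.conjTranspose).det = ((‖L.det‖ ^ 2 : ℝ) : ℂ) ∧
      ∀ z, inner ℂ z (Matrix.toEuclideanLin (A * A.conjTranspose)⁻¹ z) =
        ((‖Matrix.toEuclideanLin L⁻¹ z‖ ^ 2 : ℝ) : ℂ) := by
  obtain ⟨B, hB⟩ := exists_eq_conjTranspose_mul_self (Matrix.posSemidef_self_mul_conjTranspose A)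
  have hdet : (A * A.conjTranspose).det = ((‖B.conjTranspose.det‖ ^ 2 : ℝ) : ℂ) := by
    rw [hB, Matrix.det_mul, Matrix.det_conjTranspose, Complex.star_def, Complex.conj_mul',
      Complex.norm_conj]
    push_cast; rfl
  refine ⟨B.conjTranspose, by rw [hB, Matrix.conjTranspose_conjTranspose], fun h => ?_, hdet,
    fun z => ?_⟩
  · rw [hdet, h] at hA
    simp at hA
  · rw [hB, Matrix.mul_inv_rev]
    set C : Mat m := B.conjTranspose⁻¹ with hC
    have hBC : B⁻¹ = C.conjTranspose := by
      rw [hC, ← Matrix.conjTranspose_nonsing_inv, Matrix.conjTranspose_conjTranspose]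
    rw [hBC, toEuclideanLin_mul_apply, Matrix.toEuclideanLin_conjTranspose_eq_adjoint,
      LinearMap.adjoint_inner_right, inner_self_eq_norm_sq_to_K]
    push_cast; rfl

variable {k : ℕ} {Φ : Mat 2 →ₗ[ℂ] Mat 2} {v : Fin k → Mat 2}

/-- The determinant of `Φ^*(|x⟩⟨x|)`. -/
noncomputable def detAt (Φ : Mat 2 →ₗ[ℂ] Mat 2) (x : PC 2) : ℝ :=
  (traceDual Φ (ketBra x)).det.re

/-- The overlap `⟨x, Φ^*(|x'⟩⟨x'|) x⟩`. -/
noncomputable def overlap (Φ : Mat 2 →ₗ[ℂ] Mat 2) (x' x : PC 2) : ℝ :=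
  (traceDual Φ (ketBra x') * ketBra x).trace.re

theorem posSemidef_traceDual_ketBra (hv : IsKraus v Φ) (x : PC 2) :
    (traceDual Φ (ketBra x)).PosSemidef := by
  rw [ketBra_eq_outer, traceDual_outer hv]
  exact Matrix.posSemidef_self_mul_conjTranspose _

theorem det_eq_detAt (hv : IsKraus v Φ) (x : PC 2) :
    (traceDual Φ (ketBra x)).det = (detAt Φ x : ℂ) := by
  have h := (posSemidef_traceDual_ketBra hv x).det_nonneg
  exact Complex.eq_re_of_ofReal_le h

theorem detAt_nonneg (hv : IsKraus v Φ) (x : PC 2) : 0 ≤ detAt Φ x :=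
  (Complex.le_def.1 (posSemidef_traceDual_ketBra hv x).det_nonneg).1

theorem overlap_nonneg (hv : IsKraus v Φ) (x' x : PC 2) : 0 ≤ overlap Φ x' x := by
  rw [overlap, ketBra_eq_outer x', ketBra_eq_outer x, ← inner_toEuclideanLin_eq_trace,
    traceDual_outer hv, toEuclideanLin_mul_apply, ← LinearMap.adjoint_inner_left,
    ← Matrix.toEuclideanLin_conjTranspose_eq_adjoint]
  exact inner_self_nonneg (𝕜 := ℂ)

/-- A `2 × 2` matrix `M` of trace one has adjugate `1 - M`, so `M⁻¹ = (1 - M) / det M`. -/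
theorem inner_inv_re_eq (hv : IsKraus v Φ) (h1 : Φ 1 = 1) (x' x : PC 2) :
    (inner ℂ (unitRep x)
      (Matrix.toEuclideanLin (traceDual Φ (ketBra x'))⁻¹ (unitRep x))).re =
      (detAt Φ x')⁻¹ * (1 - overlap Φ x' x) := by
  have hadj : (traceDual Φ (ketBra x')).adjugate = 1 - traceDual Φ (ketBra x') := by
    have ht := trace_traceDual_ketBra h1 x'
    rw [Matrix.trace_fin_two] at ht
    rw [Matrix.adjugate_fin_two]
    ext i j
    fin_cases i <;> fin_cases j <;> simp [← ht]
  have hk : (ketBra x).trace = 1 := by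
    rw [ketBra_eq_outer, trace_outer, norm_unitRep]; simp
  rw [inner_toEuclideanLin_eq_trace, Matrix.inv_def, hadj, Ring.inverse_eq_inv',
    det_eq_detAt hv, Matrix.smul_mul, Matrix.trace_smul, ← ketBra_eq_outer, sub_mul, one_mul,
    Matrix.trace_sub, hk, smul_eq_mul, ← Complex.ofReal_inv, Complex.re_ofReal_mul,
    Complex.sub_re, Complex.one_re, overlap]

/-- The powers `det⁻¹` and `det³` combine into `det²`. At a singular point both sides are zero, by
the convention for division by zero. -/
theorem gapKernel_eq (hv : IsKraus v Φ) (h1 : Φ 1 = 1) (x' x : PC 2) :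
    gapKernel Φ x' x = 2 * detAt Φ x' ^ 2 * ((1 - overlap Φ x' x) ^ 3)⁻¹ := by
  rw [gapKernel, inner_inv_re_eq hv h1]
  change 2 / detAt Φ x' * _ = _
  rw [zpow_neg, show (3 : ℤ) = ((3 : ℕ) : ℤ) from rfl, zpow_natCast]
  by_cases h : detAt Φ x' = 0
  · simp [h]
  · rw [mul_pow, mul_inv]
    field_simp

/-- `(1 - overlap) / det` is `‖L⁻¹ x‖²`, with `L` invertible and `x` nonzero. -/
theorem overlap_lt_one (hv : IsKraus v Φ) (h1 : Φ 1 = 1) {x' : PC 2} (hx : detAt Φ x' ≠ 0)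
    (x : PC 2) : overlap Φ x' x < 1 := by
  have hdet : (krausMat v (unitRep x') * (krausMat v (unitRep x')).conjTranspose).det ≠ 0 := by
    rw [← traceDual_outer hv, ← ketBra_eq_outer, det_eq_detAt hv]
    exact_mod_cast hx
  obtain ⟨L, -, hL, -, hin⟩ := exists_mul_conjTranspose_eq _ hdet
  have h2 := hin (unitRep x)
  rw [← traceDual_outer hv, ← ketBra_eq_outer] at h2
  have h3 := inner_inv_re_eq hv h1 x' x
  rw [h2, Complex.ofReal_re] at h3
  have h4 : Matrix.toEuclideanLin L⁻¹ (unitRep x) ≠ 0 := by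
    intro h
    have h5 : Matrix.toEuclideanLin L (Matrix.toEuclideanLin L⁻¹ (unitRep x)) = unitRep x := by
      rw [← toEuclideanLin_mul_apply, Matrix.mul_nonsing_inv _ (isUnit_iff_ne_zero.2 hL)]
      simp
    rw [h, map_zero] at h5
    exact unitRep_ne_zero x h5.symm
  have h6 : 0 < ‖Matrix.toEuclideanLin L⁻¹ (unitRep x)‖ ^ 2 := by positivity
  have h7 : 0 < detAt Φ x' := lt_of_le_of_ne (detAt_nonneg hv x') (Ne.symm hx)
  rw [h3] at h6
  have := pos_of_mul_pos_right h6 (inv_nonneg.2 h7.le)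
  linarith

/-- The minorization: `1 - overlap` lies in `(0, 1]`, so the bound does not depend on the target
point. -/
theorem two_mul_detAt_sq_le_gapKernel (hv : IsKraus v Φ) (h1 : Φ 1 = 1) {x' : PC 2}
    (hx : detAt Φ x' ≠ 0) (x : PC 2) : 2 * detAt Φ x' ^ 2 ≤ gapKernel Φ x' x := by
  rw [gapKernel_eq hv h1]
  have h2 := overlap_lt_one hv h1 hx x
  have h3 := overlap_nonneg hv x' x
  have h4 : (1 - overlap Φ x' x) ^ 3 ≤ 1 := pow_le_one₀ (by linarith) (by linarith)
  exact le_mul_of_one_le_right (by positivity) ((one_le_inv₀ (by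
    have : 0 < 1 - overlap Φ x' x := by linarith
    positivity)).2 h4)

theorem measurable_traceDual_ketBra (hv : IsKraus v Φ) (i j : Fin 2) :
    Measurable fun x : PC 2 => traceDual Φ (ketBra x) i j := by
  simp only [traceDual_eq_sum hv, Matrix.sum_apply, Matrix.mul_apply]
  refine Finset.measurable_sum _ fun l _ => Finset.measurable_sum _ fun a _ => ?_
  refine (Finset.measurable_sum _ fun b _ => ?_).mul_const _
  exact (measurable_ketBra b a).const_mul _

theorem measurable_detAt (hv : IsKraus v Φ) : Measurable (detAt Φ) := by
  unfold detAt
  simp only [Matrix.det_fin_two]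
  have := measurable_traceDual_ketBra hv
  exact Complex.measurable_re.comp
    (((this 0 0).mul (this 1 1)).sub ((this 0 1).mul (this 1 0)))

theorem measurable_overlap (hv : IsKraus v Φ) : Measurable (Function.uncurry (overlap Φ)) := by
  unfold overlap Function.uncurry
  simp only [Matrix.trace, Matrix.diag_apply, Matrix.mul_apply]
  refine Complex.measurable_re.comp (Finset.measurable_sum _ fun i _ =>
    Finset.measurable_sum _ fun j _ => ?_)
  exact ((measurable_traceDual_ketBra hv i j).comp measurable_fst).mul
    ((measurable_ketBra j i).comp measurable_snd)

theorem measurable_gapKernel (hv : IsKraus v Φ) (h1 : Φ 1 = 1) :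
    Measurable (Function.uncurry fun x' x => ENNReal.ofReal (gapKernel Φ x' x)) := by
  have h : (Function.uncurry fun x' x => ENNReal.ofReal (gapKernel Φ x' x)) = fun p : PC 2 × PC 2 =>
      ENNReal.ofReal (2 * detAt Φ p.1 ^ 2 * ((1 - overlap Φ p.1 p.2) ^ 3)⁻¹) := by
    funext p
    simp only [Function.uncurry, gapKernel_eq hv h1]
  rw [h]
  have h2 : Measurable fun p : PC 2 × PC 2 => detAt Φ p.1 := (measurable_detAt hv).comp measurable_fst
  have h3 : Measurable fun p : PC 2 × PC 2 => overlap Φ p.1 p.2 := measurable_overlap hv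
  exact ((h2.pow_const 2).const_mul 2 |>.mul
    ((h3.const_sub 1).pow_const 3).inv).ennreal_ofReal

/-- The transition operator is an integral operator with kernel `gapKernel`, away from the points
where `Φ^*(|x⟩⟨x|)` is singular. -/
theorem transition_eq_lintegral_gapKernel [NeZero k] (hv : IsKraus v Φ) (h1 : Φ 1 = 1)
    {f : PC 2 → ℝ≥0∞} (hf : Measurable f) {x : PC 2} (hx : detAt Φ x ≠ 0) :
    transition v (muUnif k) f x =
      ∫⁻ y, ENNReal.ofReal (gapKernel Φ x y) * f y ∂(nuUnif 2) := by
  set A := krausMat v (unitRep x) with hA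
  have hM : traceDual Φ (ketBra x) = A * A.conjTranspose := traceDual_outer hv _
  have hdet : (A * A.conjTranspose).det ≠ 0 := by
    rw [← hM, det_eq_detAt hv]
    exact_mod_cast hx
  obtain ⟨L, hAL, hL, hdetL, hin⟩ := exists_mul_conjTranspose_eq _ hdet
  have hFm := measurable_homog hf
  have hlin : ∀ {m n : ℕ} (B : Matrix (Fin m) (Fin n) ℂ),
      Measurable (Matrix.toEuclideanLin B : Vec n → Vec m) := fun B =>
    (LinearMap.continuous_of_finiteDimensional _).measurable
  have hK : Measurable fun y => ENNReal.ofReal (gapKernel Φ x y) * f y :=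
    measurable_mul_left (measurable_gapKernel hv h1) hf x
  rw [transition_eq_lintegral_homog]
  simp_rw [toEuclideanLin_krausAt, ← hA]
  -- Haar row to Gaussian in `ℂ^k`, then `A` to `L` by equality of covariances, then Gaussian in
  -- `ℂ²` to directions.
  rw [muUnif, lintegral_smul_measure, smul_eq_mul, ← lintegral_gauss_eq_row
    (F := fun z => homog f (Matrix.toEuclideanLin A z)) (hFm.comp (hlin A))
    ((isHomogSq_homog f).comp_toEuclideanLin A), ← lintegral_map hFm (hlin A),
    gauss_map_eq_of_mul_conjTranspose_eq hAL, lintegral_map hFm (hlin L),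
    lintegral_gauss_comp_eq_col hL hFm (isHomogSq_homog f), lintegral_nuUnif hK]
  refine lintegral_congr fun u => ?_
  set w := Matrix.toEuclideanLin (u : Mat 2) (e₀ 2) with hw
  have hw1 : ‖w‖ = 1 := by
    rw [hw, norm_toEuclideanLin_unitary u.2]; simp [e₀]
  have hw0 : w ≠ 0 := by
    intro h
    simp [h] at hw1
  have hf1 : homog f w = f (proj w) := by simp [homog, hw1]
  rw [hf1]
  congr 2
  obtain ⟨c, hc, hcw⟩ := exists_unitRep_proj_eq hw0
  rw [hw1, mul_one] at hc
  rw [gapKernel, hM, hdetL, Complex.ofReal_re, hin, Complex.ofReal_re, hcw, map_smul, norm_smul,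
    hc, one_mul, zpow_neg, show (3 : ℤ) = ((3 : ℕ) : ℤ) from rfl, zpow_natCast, div_eq_mul_inv]

end Kernel

/-! ### Singular points and primitivity -/

section Primitivity

variable {k : ℕ} {Φ : Mat 2 →ₗ[ℂ] Mat 2} {v : Fin k → Mat 2}

theorem exists_forall_eq_smul {y : Fin 2 → ℂ} (hy : y ≠ 0) :
    ∃ p : Vec 2, ∀ w : Vec 2, y 0 * w 0 + y 1 * w 1 = 0 → ∃ a : ℂ, w = a • p := by
  refine ⟨!₂[-y 1, y 0], fun w hw => ?_⟩
  by_cases h0 : y 0 = 0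
  · have h1 : y 1 ≠ 0 := fun h1 => hy (by ext i; fin_cases i <;> simp [h0, h1])
    refine ⟨-(w 0 / y 1), ?_⟩
    have : w 1 = 0 := by simpa [h0, h1] using hw
    ext i
    fin_cases i
    · simp; field_simp
    · simp [this, h0]
  · refine ⟨w 1 / y 0, ?_⟩
    ext i
    fin_cases i
    · simp
      field_simp
      linear_combination hw
    · simp; field_simp

/-- If `Φ^*(|z⟩⟨z|)` is singular, then all vectors `v_j z` are parallel. -/
theorem exists_common_direction (hv : IsKraus v Φ) {z : Vec 2}
    (hz : (traceDual Φ (outer z)).det = 0) :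
    ∃ p : Vec 2, ∀ j, ∃ a : ℂ, Matrix.toEuclideanLin (v j) z = a • p := by
  rw [traceDual_outer hv] at hz
  -- A left null vector of `A Aᴴ` is one of `A`, so every column `v_j z` lies in the kernel of one
  -- nonzero linear form on `ℂ²`, a line.
  obtain ⟨y, hy, hy0⟩ := Matrix.exists_vecMul_eq_zero_iff.2 hz
  obtain ⟨p, hp⟩ := exists_forall_eq_smul hy
  refine ⟨p, fun j => hp _ ?_⟩
  have h1 : Matrix.vecMul y (krausMat v z) = 0 := by
    rwa [Matrix.vecMul_self_mul_conjTranspose_eq_zero] at hy0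
  have h2 := congrFun h1 j
  simpa [Matrix.vecMul, dotProduct, krausMat, Fin.sum_univ_two] using h2

/-- All `v_j z` lie on one line, which any nonzero combination spans: from a singular point the next
state is deterministic. -/
theorem traceDual_outer_eq_smul_outer (hv : IsKraus v Φ) {z : Vec 2}
    (hz : (traceDual Φ (outer z)).det = 0) {w : Vec 2} (hw : w ≠ 0) {b : Fin k → ℂ}
    (hb : w = ∑ j, b j • Matrix.toEuclideanLin (v j) z) :
    ∃ c : ℂ, traceDual Φ (outer z) = c • outer w := by
  obtain ⟨p, hp⟩ := exists_common_direction hv hz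
  choose a ha using hp
  have h1 : w = (∑ j, b j * a j) • p := by
    rw [hb, Finset.sum_smul]
    exact Finset.sum_congr rfl fun j _ => by rw [ha, smul_smul]
  set s := ∑ j, b j * a j with hs
  have hs0 : s ≠ 0 := by
    rintro h
    rw [h, zero_smul] at h1
    exact hw h1
  have h2 : p = s⁻¹ • w := by rw [h1, inv_smul_smul₀ hs0]
  refine ⟨∑ j, ((‖a j * s⁻¹‖ : ℂ)) ^ 2, ?_⟩
  rw [traceDual_outer_eq_sum hv, Finset.sum_smul]
  refine Finset.sum_congr rfl fun j _ => ?_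
  rw [ha, h2, smul_smul, outer_smul]

theorem toEuclideanLin_krausAt_eq_sum [NeZero k] (v : Fin k → Mat 2) (u : U k) (z : Vec 2) :
    Matrix.toEuclideanLin (krausAt v u) z =
      ∑ j, (u : Mat k) 0 j • Matrix.toEuclideanLin (v j) z := by
  simp [krausAt]

theorem traceDual_iterate_smul (n : ℕ) (c : ℂ) (Y : Mat 2) :
    (traceDual Φ)^[n] (c • Y) = c • (traceDual Φ)^[n] Y := by
  induction n generalizing Y with
  | zero => rfl
  | succ n ih => rw [Function.iterate_succ_apply, Function.iterate_succ_apply, traceDual_smul, ih]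

theorem trace_traceDual_iterate_mul (n : ℕ) (Y X : Mat 2) :
    ((traceDual Φ)^[n] Y * X).trace = (Y * (⇑Φ)^[n] X).trace := by
  induction n generalizing Y with
  | zero => rfl
  | succ n ih =>
    rw [Function.iterate_succ_apply, ih, trace_traceDual_mul, Function.iterate_succ_apply']

theorem outer_eq_vecMulVec (z : Vec 2) : outer z = Matrix.vecMulVec z.ofLp (star z.ofLp) := by
  ext i j
  simp [outer, Matrix.vecMulVec_apply]

/-- Iterates of the dual of a primitive map do not send pure states to pure states. -/
theorem traceDual_iterate_ne_smul_outer {n : ℕ}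
    (hn : ∀ X : Mat 2, X.PosSemidef → X ≠ 0 → ((⇑Φ)^[n] X).PosDef) {z : Vec 2} (hz : z ≠ 0)
    (c : ℂ) (w : Vec 2) : (traceDual Φ)^[n] (outer z) ≠ c • outer w := by
  intro h
  -- Testing against `|y⟩⟨y|` gives zero on the side of `|w⟩⟨w|`, but `⟨z, Φ^n(|y⟩⟨y|) z⟩ > 0` on
  -- the other.
  obtain ⟨y, hy, hyw⟩ : ∃ y : Vec 2, y ≠ 0 ∧ inner ℂ y w = 0 := by
    by_cases hw : w = 0
    · exact ⟨z, hz, by simp [hw]⟩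
    · refine ⟨!₂[-star (w 1), star (w 0)], fun h0 => hw ?_, ?_⟩
      · have e0 := congrArg (fun q : Vec 2 => q 0) h0
        have e1 := congrArg (fun q : Vec 2 => q 1) h0
        ext i
        fin_cases i
        · simpa using e1
        · simpa using e0
      · simp [PiLp.inner_apply, Fin.sum_univ_two]
        ring
  have hpos : ((⇑Φ)^[n] (outer y)).PosDef := by
    refine hn _ ?_ fun h0 => hy ?_
    · rw [outer_eq_vecMulVec]
      exact Matrix.posSemidef_vecMulVec_self_star _
    · have := trace_outer y
      rw [h0] at this
      simpa using this.symm
  have h1 := trace_traceDual_iterate_mul (Φ := Φ) n (outer z) (outer y)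
  rw [h, Matrix.smul_mul, Matrix.trace_smul, ← inner_toEuclideanLin_eq_trace] at h1
  have h2 : inner ℂ y (Matrix.toEuclideanLin (outer w) y) = 0 := by
    have : Matrix.toEuclideanLin (outer w) y = (inner ℂ w y) • w := by
      ext i
      simp only [Matrix.toLpLin_apply, outer, Matrix.mulVec, dotProduct, Matrix.of_apply,
        PiLp.smul_apply, smul_eq_mul, PiLp.inner_apply, RCLike.inner_apply, Finset.sum_mul]
      exact Finset.sum_congr rfl fun j _ => by rw [Complex.star_def]; ring
    rw [this, inner_smul_right, hyw, mul_zero]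
  rw [h2, smul_zero, Matrix.trace_mul_comm, ← inner_toEuclideanLin_eq_trace] at h1
  have h3 := hpos.dotProduct_mulVec_pos (x := z.ofLp) (fun h0 => hz (by ext i; simp [h0]))
  have h4 : inner ℂ z (Matrix.toEuclideanLin ((⇑Φ)^[n] (outer y)) z) =
      star z.ofLp ⬝ᵥ ((⇑Φ)^[n] (outer y)).mulVec z.ofLp := by
    simp only [PiLp.inner_apply, dotProduct, Matrix.toLpLin_apply, RCLike.inner_apply,
      Pi.star_apply, Complex.star_def]
    exact Finset.sum_congr rfl fun j _ => mul_comm _ _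
  rw [← h4, ← h1] at h3
  exact lt_irrefl _ h3

theorem exists_unitary_row_eq [NeZero k] {a : Vec k} (ha : ‖a‖ = 1) :
    ∃ g : U k, Matrix.toEuclideanLin (g : Mat k).transpose (e₀ k) = a := by
  obtain ⟨g, hg⟩ := exists_unitary_smul_eq a
  refine ⟨⟨(g : Mat k).transpose, transpose_mem_unitaryGroup g.2⟩, ?_⟩
  rw [ha] at hg
  simpa using hg.symm

theorem toEuclideanLin_krausMat_single (v : Fin k → Mat 2) (z : Vec 2) (i : Fin k) :
    Matrix.toEuclideanLin (krausMat v z) (EuclideanSpace.single i 1) =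
      Matrix.toEuclideanLin (v i) z := by
  ext l
  simp [krausMat, Matrix.toLpLin_apply]

/-- A unitary whose first row is a basis vector recovers a single Kraus operator. -/
theorem exists_krausAt_apply_eq [NeZero k] (v : Fin k → Mat 2) (z : Vec 2) (i : Fin k) :
    ∃ u : U k, Matrix.toEuclideanLin (krausAt v u) z = Matrix.toEuclideanLin (v i) z := by
  obtain ⟨u, hu⟩ := exists_unitary_row_eq (a := EuclideanSpace.single i (1 : ℂ)) (by simp)
  exact ⟨u, by rw [toEuclideanLin_krausAt, hu, toEuclideanLin_krausMat_single]⟩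

/-- The average of `2 (det Φ^*(|w⟩⟨w|))²`, where `w` is the unnormalized state after `j` steps of
the trajectory started from `z`. -/
noncomputable def meanDetSq [NeZero k] (Φ : Mat 2 →ₗ[ℂ] Mat 2) (v : Fin k → Mat 2) :
    ℕ → Vec 2 → ℝ
  | 0, z => 2 * (traceDual Φ (outer z)).det.re ^ 2
  | j + 1, z => ∫ u, meanDetSq Φ v j (Matrix.toEuclideanLin (krausAt v u) z) ∂(muUnif k)

theorem continuous_krausAt_apply [NeZero k] (v : Fin k → Mat 2) :
    Continuous fun p : Vec 2 × U k => Matrix.toEuclideanLin (krausAt v p.2) p.1 := by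
  simp only [toEuclideanLin_krausAt_eq_sum]
  have h1 : Continuous fun p : Vec 2 × U k => (p.2 : Mat k) :=
    continuous_subtype_val.comp continuous_snd
  refine continuous_finsetSum _ fun j _ => (h1.matrix_elem 0 j).smul ?_
  exact (LinearMap.continuous_of_finiteDimensional _).comp continuous_fst

/-- Turns the vanishing of a continuous function for almost every `u` into vanishing for every `u`.
-/
instance instIsOpenPosMeasureMuUnif [NeZero k] : (muUnif k).IsOpenPosMeasure := by
  refine ⟨fun V hV hne h => ?_⟩
  rw [muUnif, Measure.smul_apply, smul_eq_mul, mul_eq_zero] at h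
  rcases h with h | h
  · exact NeZero.ne k (by exact_mod_cast h)
  · exact hV.measure_ne_zero (haarProb k) hne h

theorem continuous_meanDetSq [NeZero k] (hv : IsKraus v Φ) (j : ℕ) :
    Continuous (meanDetSq Φ v j) := by
  induction j with
  | zero =>
    have h : Continuous fun z : Vec 2 => traceDual Φ (outer z) := by
      simp only [traceDual_eq_sum hv, outer]
      refine continuous_finsetSum _ fun l _ => ?_
      refine (continuous_const.matrix_mul ?_).matrix_mul continuous_const
      exact continuous_matrix fun a b => by
        simp only [Matrix.of_apply]
        fun_prop
    change Continuous fun z => 2 * (traceDual Φ (outer z)).det.re ^ 2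
    exact continuous_const.mul ((Complex.continuous_re.comp h.matrix_det).pow 2)
  | succ j ih =>
    have h := continuous_parametric_integral_of_continuous (μ := muUnif k)
      (f := fun z u => meanDetSq Φ v j (Matrix.toEuclideanLin (krausAt v u) z))
      (ih.comp (continuous_krausAt_apply v)) isCompact_univ
    simp only [Measure.restrict_univ] at h
    exact h

theorem continuous_meanDetSq_krausAt [NeZero k] (hv : IsKraus v Φ) (j : ℕ) (z : Vec 2) :
    Continuous fun u : U k => meanDetSq Φ v j (Matrix.toEuclideanLin (krausAt v u) z) := by
  have h : Continuous fun u : U k => Matrix.toEuclideanLin (krausAt v u) z := by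
    simp only [toEuclideanLin_krausAt_eq_sum]
    have h1 : Continuous fun u : U k => (u : Mat k) := continuous_subtype_val
    exact continuous_finsetSum _ fun j _ => (h1.matrix_elem 0 j).smul continuous_const
  exact (continuous_meanDetSq hv j).comp h

theorem meanDetSq_nonneg [NeZero k] (Φ : Mat 2 →ₗ[ℂ] Mat 2) (v : Fin k → Mat 2) (j : ℕ)
    (z : Vec 2) : 0 ≤ meanDetSq Φ v j z := by
  induction j generalizing z with
  | zero => unfold meanDetSq; positivity
  | succ j ih => exact integral_nonneg fun u => ih _

/-- `|cz⟩⟨cz|` carries `|c|²`, its `2 × 2` determinant `|c|⁴`, and the square `|c|⁸`; the steps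
`v(u)` are linear and preserve the degree. -/
theorem meanDetSq_smul [NeZero k] (Φ : Mat 2 →ₗ[ℂ] Mat 2) (v : Fin k → Mat 2) (j : ℕ) (c : ℂ)
    (z : Vec 2) : meanDetSq Φ v j (c • z) = ‖c‖ ^ 8 * meanDetSq Φ v j z := by
  induction j generalizing z with
  | zero =>
    simp only [meanDetSq, outer_smul, traceDual_smul, Matrix.det_smul, Fintype.card_fin]
    rw [← pow_mul, ← Complex.ofReal_pow, Complex.re_ofReal_mul]
    ring
  | succ j ih =>
    simp only [meanDetSq, map_smul, ih]
    rw [integral_const_mul]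

/-- Induction along the deterministic path: the term `j = 0` makes `z` singular, and the later terms
pass to any nonzero `v_i z`. -/
theorem exists_iterate_eq_smul_outer [NeZero k] (hv : IsKraus v Φ) (n : ℕ) {z : Vec 2}
    (hz : ∀ j < n, meanDetSq Φ v j z = 0) :
    ∃ (c : ℂ) (w : Vec 2), (traceDual Φ)^[n] (outer z) = c • outer w := by
  induction n generalizing z with
  | zero => exact ⟨1, z, by simp⟩
  | succ n ih =>
    have hdet : (traceDual Φ (outer z)).det = 0 := by
      have h0 := hz 0 (Nat.succ_pos n)
      rw [meanDetSq] at h0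
      have h1 : (traceDual Φ (outer z)).det.re = 0 := by simpa using h0
      have h2 : 0 ≤ (traceDual Φ (outer z)).det := by
        rw [traceDual_outer hv]
        exact (Matrix.posSemidef_self_mul_conjTranspose _).det_nonneg
      exact Complex.ext h1 (Complex.le_def.1 h2).2.symm
    by_cases hall : ∀ i, Matrix.toEuclideanLin (v i) z = 0
    · refine ⟨0, 0, ?_⟩
      have h1 : traceDual Φ (outer z) = (0 : ℂ) • (0 : Mat 2) := by
        rw [traceDual_outer_eq_sum hv, zero_smul]
        refine Finset.sum_eq_zero fun l _ => ?_
        rw [hall l]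
        ext i j
        simp [outer]
      rw [Function.iterate_succ_apply, h1, traceDual_iterate_smul, zero_smul, zero_smul]
    · push Not at hall
      obtain ⟨i, hi⟩ := hall
      obtain ⟨u, hu⟩ := exists_krausAt_apply_eq v z i
      obtain ⟨c, hc⟩ := traceDual_outer_eq_smul_outer hv hdet hi (b := Pi.single i 1) (by
        simp [Pi.single_apply])
      have hw : ∀ j < n, meanDetSq Φ v j (Matrix.toEuclideanLin (v i) z) = 0 := by
        intro j hj
        have h0 := hz (j + 1) (Nat.succ_lt_succ hj)
        rw [meanDetSq] at h0
        have hcont := continuous_meanDetSq_krausAt hv j z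
        -- A nonnegative continuous function of `u` with zero integral vanishes identically, in
        -- particular at the unitary realizing `v i`.
        rw [integral_eq_zero_iff_of_nonneg (fun u => meanDetSq_nonneg Φ v j _)
          (hcont.integrable_of_hasCompactSupport (HasCompactSupport.of_compactSpace _))] at h0
        have h1 := (hcont.ae_eq_iff_eq (muUnif k) continuous_const).1 h0
        rw [← hu]
        exact congrFun h1 u
      obtain ⟨c', w', h'⟩ := ih hw
      exact ⟨c * c', w', by
        rw [Function.iterate_succ_apply, hc, traceDual_iterate_smul, h', smul_smul]⟩

theorem exists_meanDetSq_pos [NeZero k] (hv : IsKraus v Φ) {n : ℕ}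
    (hn : ∀ X : Mat 2, X.PosSemidef → X ≠ 0 → ((⇑Φ)^[n] X).PosDef) {z : Vec 2} (hz : z ≠ 0) :
    0 < ∑ j ∈ Finset.range n, meanDetSq Φ v j z := by
  refine lt_of_le_of_ne (Finset.sum_nonneg fun j _ => meanDetSq_nonneg Φ v j z) fun h => ?_
  have h0 := (Finset.sum_eq_zero_iff_of_nonneg fun j _ => meanDetSq_nonneg Φ v j z).1 h.symm
  obtain ⟨c, w, hcw⟩ := exists_iterate_eq_smul_outer hv n
    (fun j hj => h0 j (Finset.mem_range.2 hj))
  exact traceDual_iterate_ne_smul_outer hn hz c w hcw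

end Primitivity

/-! ### The singular points form a null set -/

section NullSet

variable {k : ℕ} {Φ : Mat 2 →ₗ[ℂ] Mat 2} {v : Fin k → Mat 2}

/-- The quadratic formula, with `δ` a square root of the discriminant; for `α = 0` the factor `y`
splits off. -/
theorem exists_quadratic_factor (α β γ : ℂ) :
    ∃ a b c e : ℂ, ∀ x y : ℂ,
      α * x ^ 2 + β * (x * y) + γ * y ^ 2 = (a * x + b * y) * (c * x + e * y) := by
  by_cases h : α = 0
  · exact ⟨0, 1, β, γ, fun x y => by rw [h]; ring⟩
  · obtain ⟨δ, hδ⟩ := IsAlgClosed.exists_pow_nat_eq (β ^ 2 - 4 * α * γ) two_pos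
    refine ⟨α, (β - δ) / 2, 1, (β + δ) / (2 * α), fun x y => ?_⟩
    field_simp
    linear_combination (y ^ 2) * hδ

theorem volume_linear_zero {a b : ℂ} {z₀ : Vec 2} (h : a * z₀ 0 + b * z₀ 1 ≠ 0) :
    volume {z : Vec 2 | a * z 0 + b * z 1 = 0} = 0 := by
  let s : Submodule ℝ (Vec 2) :=
    { carrier := {z : Vec 2 | a * z 0 + b * z 1 = 0}
      add_mem' := fun {x y} hx hy => by
        simp only [Set.mem_ofPred_eq, PiLp.add_apply] at *
        linear_combination hx + hy
      zero_mem' := by simp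
      smul_mem' := fun c x hx => by
        simp only [Set.mem_ofPred_eq, PiLp.smul_apply, Complex.real_smul] at *
        linear_combination (c : ℂ) * hx }
  exact Measure.addHaar_submodule volume s fun hs => h (by
    have : z₀ ∈ s := hs ▸ Submodule.mem_top
    exact this)

theorem volume_quadratic_zero {α β γ : ℂ} {z₀ : Vec 2}
    (h : α * z₀ 0 ^ 2 + β * (z₀ 0 * z₀ 1) + γ * z₀ 1 ^ 2 ≠ 0) :
    volume {z : Vec 2 | α * z 0 ^ 2 + β * (z 0 * z 1) + γ * z 1 ^ 2 = 0} = 0 := by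
  obtain ⟨a, b, c, e, hf⟩ := exists_quadratic_factor α β γ
  simp only [hf] at h ⊢
  refine measure_mono_null (fun z hz => ?_) (measure_union_null
    (volume_linear_zero (left_ne_zero_of_mul h)) (volume_linear_zero (right_ne_zero_of_mul h)))
  exact mul_eq_zero.1 hz

/-- The minors of the matrix with columns `v_j z`. -/
noncomputable def minor (v : Fin k → Mat 2) (i j : Fin k) (z : Vec 2) : ℂ :=
  Matrix.toEuclideanLin (v i) z 0 * Matrix.toEuclideanLin (v j) z 1 -
    Matrix.toEuclideanLin (v i) z 1 * Matrix.toEuclideanLin (v j) z 0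

/-- Cauchy–Binet: the determinant of `A Aᴴ` is a combination of conjugated minors, so it vanishes
when they all do. -/
theorem exists_minor_ne_zero (hv : IsKraus v Φ) {z : Vec 2}
    (hz : (traceDual Φ (outer z)).det ≠ 0) : ∃ i j, minor v i j z ≠ 0 := by
  by_contra! h
  refine hz ?_
  rw [traceDual_outer hv, Matrix.det_fin_two]
  simp only [Matrix.mul_apply, krausMat, Matrix.of_apply, Matrix.conjTranspose_apply]
  rw [Finset.sum_mul_sum, Finset.sum_mul_sum, ← Finset.sum_sub_distrib]
  refine Finset.sum_eq_zero fun i _ => ?_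
  rw [← Finset.sum_sub_distrib]
  refine Finset.sum_eq_zero fun j _ => ?_
  have h1 := congrArg star (h i j)
  simp only [minor, star_sub, star_mul', star_zero] at h1
  linear_combination (Matrix.toEuclideanLin (v i) z 0 * Matrix.toEuclideanLin (v j) z 1) * h1

theorem minor_eq_zero (hv : IsKraus v Φ) {z : Vec 2} (hz : (traceDual Φ (outer z)).det = 0)
    (i j : Fin k) : minor v i j z = 0 := by
  obtain ⟨p, hp⟩ := exists_common_direction hv hz
  obtain ⟨a, ha⟩ := hp i
  obtain ⟨b, hb⟩ := hp j
  simp only [minor, ha, hb, PiLp.smul_apply, smul_eq_mul]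
  ring

/-- The determinant is a real quartic in `z`, but the minors are complex quadratic forms, hence
products of linear forms; one that is nonzero at `z₀` suffices. -/
theorem volume_det_traceDual_outer_eq_zero (hv : IsKraus v Φ) {z₀ : Vec 2}
    (h₀ : (traceDual Φ (outer z₀)).det ≠ 0) :
    volume {z : Vec 2 | (traceDual Φ (outer z)).det = 0} = 0 := by
  obtain ⟨i, j, hij⟩ := exists_minor_ne_zero hv h₀
  have h : ∀ z, minor v i j z = (v i 0 0 * v j 1 0 - v i 1 0 * v j 0 0) * z 0 ^ 2 +
      (v i 0 0 * v j 1 1 + v i 0 1 * v j 1 0 - v i 1 0 * v j 0 1 - v i 1 1 * v j 0 0) *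
        (z 0 * z 1) + (v i 0 1 * v j 1 1 - v i 1 1 * v j 0 1) * z 1 ^ 2 := fun z => by
    simp only [minor, Matrix.toLpLin_apply, Matrix.mulVec, dotProduct, Fin.sum_univ_two]
    ring
  rw [h] at hij
  refine measure_mono_null (fun z hz => ?_) (volume_quadratic_zero hij)
  have := minor_eq_zero hv hz i j
  rwa [h] at this

theorem det_traceDual_outer_of_proj {z : Vec 2} (hz : z ≠ 0) (h : detAt Φ (proj z) = 0)
    (hv : IsKraus v Φ) : (traceDual Φ (outer z)).det = 0 := by
  have h1 := det_eq_detAt hv (proj z)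
  rw [h, ketBra_proj hz, traceDual_smul, Matrix.det_smul] at h1
  have h2 : ((‖z‖⁻¹ : ℝ) : ℂ) ≠ 0 := by simpa using hz
  simpa [h2, hz] using h1

/-- `Φ^*(|x⟩⟨x|)` is almost everywhere invertible, as soon as it is invertible for some vector. -/
theorem ae_detAt_ne_zero (hv : IsKraus v Φ) {z₀ : Vec 2}
    (h₀ : (traceDual Φ (outer z₀)).det ≠ 0) : ∀ᵐ x ∂(nuUnif 2), detAt Φ x ≠ 0 := by
  set Z : Set (PC 2) := {x | detAt Φ x = 0} with hZ
  have hZm : MeasurableSet Z := measurable_detAt hv (measurableSet_singleton 0)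
  have hfm : Measurable (Z.indicator (1 : PC 2 → ℝ≥0∞)) := measurable_one.indicator hZm
  -- With `L = 1` the formula transfers null cones in `ℂ²` to null sets for `nuUnif`.
  have h1 := lintegral_gauss_comp_eq_col (L := 1) (by simp) (measurable_homog hfm)
    (isHomogSq_homog _)
  have h2 : ∫⁻ z, homog (Z.indicator 1) (Matrix.toEuclideanLin (1 : Mat 2) z) ∂(gauss 2) = 0 := by
    have hm : Measurable fun z =>
        homog (Z.indicator 1) (Matrix.toEuclideanLin (1 : Mat 2) z) :=
      (measurable_homog hfm).comp (LinearMap.continuous_of_finiteDimensional _).measurable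
    rw [lintegral_eq_zero_iff hm]
    refine (withDensity_absolutelyContinuous _ _).ae_le ?_
    refine measure_mono_null (fun z hz => ?_) (volume_det_traceDual_outer_eq_zero hv h₀)
    have hz' : homog (Z.indicator 1) z ≠ 0 := by simpa using hz
    rw [homog, mul_ne_zero_iff] at hz'
    have hz0 : z ≠ 0 := by
      rintro rfl
      simp at hz'
    have hzZ : proj z ∈ Z := by
      by_contra hn
      exact hz'.2 (Set.indicator_of_notMem hn _)
    exact det_traceDual_outer_of_proj hz0 hzZ hv
  rw [h2] at h1
  have h3 : ∀ u : U 2, ‖Matrix.toEuclideanLin (u : Mat 2) (e₀ 2)‖ = 1 := fun u => by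
    rw [norm_toEuclideanLin_unitary u.2]; simp [e₀]
  simp only [inv_one, Matrix.det_one, norm_one, one_pow, mul_one, homog] at h1
  have h4 : ∀ u : U 2, Matrix.toEuclideanLin (1 : Mat 2)
      (Matrix.toEuclideanLin (u : Mat 2) (e₀ 2)) = Matrix.toEuclideanLin (u : Mat 2) (e₀ 2) :=
    fun u => by simp
  simp only [h4, h3, one_pow, inv_one, mul_one, ENNReal.ofReal_one, one_mul] at h1
  rw [lintegral_const_mul' _ _ ENNReal.ofReal_ne_top, ← lintegral_nuUnif hfm,
    lintegral_indicator_one hZm] at h1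
  rw [ae_iff]
  simpa using h1.symm

end NullSet

/-! ### Mass conservation and the Lyapunov function -/

section Lyapunov

variable {k : ℕ} [NeZero k] {Φ : Mat 2 →ₗ[ℂ] Mat 2} {v : Fin k → Mat 2}

theorem sum_norm_sq_apply_single {m n : ℕ} (B : Matrix (Fin m) (Fin n) ℂ) :
    ∑ j, ‖Matrix.toEuclideanLin B (EuclideanSpace.single j 1)‖ ^ 2 =
      (B * B.conjTranspose).trace.re := by
  simp only [EuclideanSpace.norm_sq_eq, Matrix.trace, Matrix.diag_apply, Matrix.mul_apply,
    Matrix.conjTranspose_apply, Complex.re_sum]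
  rw [Finset.sum_comm]
  refine Finset.sum_congr rfl fun i _ => Finset.sum_congr rfl fun j _ => ?_
  rw [Complex.star_def, Complex.mul_conj', ← Complex.ofReal_pow, Complex.ofReal_re]
  simp [Matrix.toLpLin_apply]

omit [NeZero k] in
theorem trace_krausMat (hv : IsKraus v Φ) (h1 : Φ 1 = 1) {z : Vec 2} (hz : ‖z‖ = 1) :
    (krausMat v z * (krausMat v z).conjTranspose).trace = 1 := by
  rw [← traceDual_outer hv, trace_traceDual h1, trace_outer, hz]
  simp

theorem lintegral_haarProb_row_eq {F : Vec k → ℝ≥0∞} {a : Vec k} (ha : ‖a‖ = 1) :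
    ∫⁻ u : U k, F (Matrix.toEuclideanLin (u : Mat k).transpose (e₀ k)) ∂(haarProb k) =
      ∫⁻ u : U k, F (Matrix.toEuclideanLin (u : Mat k).transpose a) ∂(haarProb k) := by
  obtain ⟨g, hg⟩ := exists_unitary_row_eq ha
  rw [← lintegral_mul_left_eq_self (μ := haarProb k)
    (fun u : U k => F (Matrix.toEuclideanLin (u : Mat k).transpose (e₀ k))) g]
  refine lintegral_congr fun u => ?_
  rw [← hg, ← toEuclideanLin_mul_apply, Submonoid.coe_mul, Matrix.transpose_mul]

/-- All rows of a Haar unitary have the same law, so `k` times the mean over the first row is the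
mean of the sum over all rows. That sum is `tr(A Aᴴ) = 1` for every `u`. Singular points are covered
too. -/
theorem lintegral_norm_sq_krausAt (hv : IsKraus v Φ) (h1 : Φ 1 = 1) {z : Vec 2} (hz : ‖z‖ = 1) :
    ∫⁻ u, ENNReal.ofReal (‖Matrix.toEuclideanLin (krausAt v u) z‖ ^ 2) ∂(muUnif k) = 1 := by
  set A := krausMat v z with hA
  simp_rw [toEuclideanLin_krausAt, ← hA]
  rw [muUnif, lintegral_smul_measure, smul_eq_mul]
  have h2 : ∀ j : Fin k, ∫⁻ u : U k, ENNReal.ofReal (‖Matrix.toEuclideanLin A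
      (Matrix.toEuclideanLin (u : Mat k).transpose (e₀ k))‖ ^ 2) ∂(haarProb k) =
      ∫⁻ u : U k, ENNReal.ofReal (‖Matrix.toEuclideanLin (A * (u : Mat k).transpose)
      (EuclideanSpace.single j 1)‖ ^ 2) ∂(haarProb k) := fun j => by
    rw [lintegral_haarProb_row_eq
      (F := fun w => ENNReal.ofReal (‖Matrix.toEuclideanLin A w‖ ^ 2))
      (a := EuclideanSpace.single j (1 : ℂ)) (by simp)]
    simp_rw [toEuclideanLin_mul_apply]
  have h3 : (k : ℝ≥0∞) * ∫⁻ u : U k, ENNReal.ofReal (‖Matrix.toEuclideanLin A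
      (Matrix.toEuclideanLin (u : Mat k).transpose (e₀ k))‖ ^ 2) ∂(haarProb k) =
      ∑ _j : Fin k, ∫⁻ u : U k, ENNReal.ofReal (‖Matrix.toEuclideanLin A
      (Matrix.toEuclideanLin (u : Mat k).transpose (e₀ k))‖ ^ 2) ∂(haarProb k) := by
    simp
  rw [h3, Finset.sum_congr rfl fun j _ => h2 j, ← lintegral_finsetSum]
  · have h4 : ∀ u : U k, ∑ j, ENNReal.ofReal (‖Matrix.toEuclideanLin (A * (u : Mat k).transpose)
        (EuclideanSpace.single j 1)‖ ^ 2) = 1 := fun u => by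
      rw [← ENNReal.ofReal_sum_of_nonneg fun j _ => by positivity, sum_norm_sq_apply_single,
        Matrix.conjTranspose_mul, Matrix.mul_assoc, ← Matrix.mul_assoc (u : Mat k).transpose]
      have h5 : (u : Mat k).transpose * (u : Mat k).transpose.conjTranspose = 1 :=
        Matrix.mem_unitaryGroup_iff.1 (transpose_mem_unitaryGroup u.2)
      rw [h5, Matrix.one_mul, trace_krausMat hv h1 hz]
      simp
    rw [lintegral_congr h4]
    simp
  · intro j _
    refine Measurable.ennreal_ofReal (Measurable.pow_const (Measurable.norm ?_) 2)
    simp only [toEuclideanLin_mul_apply]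
    exact (LinearMap.continuous_of_finiteDimensional (Matrix.toEuclideanLin A)).measurable.comp
      (measurable_toEuclideanLin_comp (fun i j => measurable_entry j i) measurable_const)

theorem transition_const (hv : IsKraus v Φ) (h1 : Φ 1 = 1) {c : ℝ≥0∞} (hc : c ≠ ∞) (x : PC 2) :
    transition v (muUnif k) (fun _ => c) x = c := by
  rw [transition, lintegral_const_mul' _ _ hc,
    lintegral_norm_sq_krausAt hv h1 (norm_unitRep x), mul_one]

/-- Cauchy–Schwarz, with a unit row and `∑ ‖v_j z‖² = 1`. -/
theorem norm_krausAt_apply_le_one (hv : IsKraus v Φ) (h1 : Φ 1 = 1) (u : U k) {z : Vec 2}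
    (hz : ‖z‖ = 1) : ‖Matrix.toEuclideanLin (krausAt v u) z‖ ≤ 1 := by
  rw [toEuclideanLin_krausAt]
  set a := Matrix.toEuclideanLin (u : Mat k).transpose (e₀ k) with ha
  set A := krausMat v z with hA
  have ha1 : ‖a‖ = 1 := by
    rw [ha, norm_toEuclideanLin_unitary (transpose_mem_unitaryGroup u.2)]; simp [e₀]
  have h2 : Matrix.toEuclideanLin A a =
      ∑ j, a j • Matrix.toEuclideanLin A (EuclideanSpace.single j 1) := by
    conv_lhs => rw [← (EuclideanSpace.basisFun (Fin k) ℂ).sum_repr a]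
    simp [map_sum]
  have h3 : ∑ j, ‖Matrix.toEuclideanLin A (EuclideanSpace.single j 1)‖ ^ 2 = 1 := by
    rw [sum_norm_sq_apply_single, trace_krausMat hv h1 hz, Complex.one_re]
  have h4 : ∑ j, ‖a j‖ ^ 2 = 1 := by rw [← EuclideanSpace.norm_sq_eq, ha1, one_pow]
  rw [h2]
  calc ‖∑ j, a j • Matrix.toEuclideanLin A (EuclideanSpace.single j 1)‖
      ≤ ∑ j, ‖a j‖ * ‖Matrix.toEuclideanLin A (EuclideanSpace.single j 1)‖ :=
        (norm_sum_le _ _).trans_eq (Finset.sum_congr rfl fun j _ => norm_smul _ _)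
    _ ≤ 1 := by
        have := Finset.sum_mul_sq_le_sq_mul_sq Finset.univ (fun j => ‖a j‖)
          (fun j => ‖Matrix.toEuclideanLin A (EuclideanSpace.single j 1)‖)
        rw [h3, h4, one_mul] at this
        exact (sq_le_one_iff₀ (Finset.sum_nonneg fun j _ => by positivity)).1 this

/-- By homogeneity of degree eight the right side is `‖w‖⁻⁶` times the left when `w ≠ 0`. So the
recursion on unnormalized vectors, which is continuous, bounds the true transition from below. -/
theorem meanDetSq_le_of_norm_le_one (j : ℕ) {w : Vec 2} (hw : ‖w‖ ≤ 1) :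
    meanDetSq Φ v j w ≤ ‖w‖ ^ 2 * meanDetSq Φ v j (unitRep (proj w)) := by
  by_cases h : w = 0
  · have := meanDetSq_smul Φ v j 0 (0 : Vec 2)
    simp only [smul_zero, norm_zero] at this
    rw [h, this]
    simp
  · obtain ⟨c, hc, hcw⟩ := exists_unitRep_proj_eq h
    have h1 : w = (‖w‖ : ℂ) • ((‖w‖ : ℂ)⁻¹ • w) := by
      rw [smul_inv_smul₀]; simpa using h
    have h2 : meanDetSq Φ v j (unitRep (proj w)) =
        ‖c‖ ^ 8 * meanDetSq Φ v j w := by rw [hcw, meanDetSq_smul]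
    have hw0 : 0 < ‖w‖ := norm_pos_iff.2 h
    have h3 : 1 ≤ ‖w‖ ^ 2 * ‖c‖ ^ 8 := by
      have hc1 : 1 ≤ ‖c‖ := by
        by_contra! hlt
        nlinarith [norm_nonneg c]
      calc (1 : ℝ) ≤ ‖c‖ ^ 6 := one_le_pow₀ hc1
        _ = (‖c‖ * ‖w‖) ^ 2 * ‖c‖ ^ 6 := by rw [hc]; ring
        _ = _ := by ring
    rw [h2, ← mul_assoc]
    exact le_mul_of_one_le_left (meanDetSq_nonneg Φ v j w) h3

theorem measurable_meanDetSq_unitRep (hv : IsKraus v Φ) (j : ℕ) :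
    Measurable fun x : PC 2 => meanDetSq Φ v j (unitRep x) := by
  obtain ⟨σ, hσ, hσ'⟩ := exists_measurable_section
  have h : (fun x : PC 2 => meanDetSq Φ v j (unitRep x)) = fun x => meanDetSq Φ v j (σ x) := by
    funext x
    obtain ⟨c, hc, hcx⟩ := hσ' x
    rw [hcx, meanDetSq_smul, hc, one_pow, one_mul]
  rw [h]
  exact (continuous_meanDetSq hv j).measurable.comp hσ

theorem integrable_meanDetSq_krausAt (hv : IsKraus v Φ) (j : ℕ) (z : Vec 2) :
    Integrable (fun u : U k => meanDetSq Φ v j (Matrix.toEuclideanLin (krausAt v u) z))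
      (muUnif k) :=
  (continuous_meanDetSq_krausAt hv j z).integrable_of_hasCompactSupport
    (HasCompactSupport.of_compactSpace _)

/-- The linear combination of the `meanDetSq` that decreases along the trajectory. -/
noncomputable def potential (Φ : Mat 2 →ₗ[ℂ] Mat 2) (v : Fin k → Mat 2) (n : ℕ) (z : Vec 2) : ℝ :=
  ∑ j ∈ Finset.range n, ((n : ℝ) - j) * meanDetSq Φ v j z

/-- Summation by parts: the shift of the index raises every weight by one, at the cost of the term
`j = 0` with weight `n + 1`. -/
theorem sum_meanDetSq_succ (n : ℕ) (z : Vec 2) :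
    ∑ j ∈ Finset.range n, ((n : ℝ) - j) * meanDetSq Φ v (j + 1) z +
      (n + 1) * meanDetSq Φ v 0 z =
      potential Φ v n z + ∑ j ∈ Finset.range (n + 1), meanDetSq Φ v j z := by
  have h1 : ∑ j ∈ Finset.range (n + 1), ((n : ℝ) + 1 - j) * meanDetSq Φ v j z =
      ∑ j ∈ Finset.range n, ((n : ℝ) - j) * meanDetSq Φ v (j + 1) z +
      (n + 1) * meanDetSq Φ v 0 z := by
    rw [Finset.sum_range_succ']
    congr 1
    · exact Finset.sum_congr rfl fun j _ => by push_cast; ring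
    · push_cast; ring
  have h2 : ∑ j ∈ Finset.range (n + 1), ((n : ℝ) - j) * meanDetSq Φ v j z =
      potential Φ v n z := by
    rw [Finset.sum_range_succ, potential]; simp
  rw [← h1, ← h2, ← Finset.sum_add_distrib]
  exact Finset.sum_congr rfl fun j _ => by ring

theorem potential_nonneg (n : ℕ) (z : Vec 2) : 0 ≤ potential Φ v n z := by
  refine Finset.sum_nonneg fun j hj => mul_nonneg ?_ (meanDetSq_nonneg Φ v j z)
  have : (j : ℝ) ≤ n := by exact_mod_cast (Finset.mem_range.1 hj).le
  linarith

theorem le_transition_potential (hv : IsKraus v Φ) (h1 : Φ 1 = 1) (n : ℕ) {ε : ℝ} (hε : 0 < ε)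
    (x : PC 2) :
    ENNReal.ofReal ((∑ j ∈ Finset.range n, ((n : ℝ) - j) * meanDetSq Φ v (j + 1) (unitRep x)) / ε) ≤
      transition v (muUnif k) (fun y => ENNReal.ofReal (potential Φ v n (unitRep y) / ε)) x := by
  have h2 : ∑ j ∈ Finset.range n, ((n : ℝ) - j) * meanDetSq Φ v (j + 1) (unitRep x) =
      ∫ u, potential Φ v n (Matrix.toEuclideanLin (krausAt v u) (unitRep x)) ∂(muUnif k) := by
    simp only [potential, meanDetSq]
    rw [integral_finsetSum _ fun j _ =>
      (integrable_meanDetSq_krausAt hv j (unitRep x)).const_mul _]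
    exact Finset.sum_congr rfl fun j _ => (integral_const_mul _ _).symm
  have hint : Integrable (fun u => potential Φ v n
      (Matrix.toEuclideanLin (krausAt v u) (unitRep x)) / ε) (muUnif k) := by
    refine Integrable.div_const ?_ _
    simp only [potential]
    exact integrable_finsetSum _ fun j _ =>
      (integrable_meanDetSq_krausAt hv j (unitRep x)).const_mul _
  rw [h2, ← integral_div, ofReal_integral_eq_lintegral_ofReal hint
    (ae_of_all _ fun u => div_nonneg (potential_nonneg n _) hε.le), transition_eq_lintegral_homog]
  refine lintegral_mono fun u => ?_
  set w := Matrix.toEuclideanLin (krausAt v u) (unitRep x) with hw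
  have hw1 : ‖w‖ ≤ 1 := norm_krausAt_apply_le_one hv h1 u (norm_unitRep x)
  rw [homog, ← ENNReal.ofReal_mul (by positivity)]
  refine ENNReal.ofReal_le_ofReal ?_
  rw [← mul_div_assoc]
  gcongr
  rw [potential, potential, Finset.mul_sum]
  refine Finset.sum_le_sum fun j hj => ?_
  have h3 : (0 : ℝ) ≤ (n : ℝ) - j := by
    have : (j : ℝ) ≤ n := by exact_mod_cast (Finset.mem_range.1 hj).le
    linarith
  calc ((n : ℝ) - j) * meanDetSq Φ v j w
      ≤ ((n : ℝ) - j) * (‖w‖ ^ 2 * meanDetSq Φ v j (unitRep (proj w))) :=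
        mul_le_mul_of_nonneg_left (meanDetSq_le_of_norm_le_one j hw1) h3
    _ = _ := by ring

theorem transition_add (v : Fin k → Mat 2) {f g : PC 2 → ℝ≥0∞} (hf : Measurable f) (x : PC 2) :
    transition v (muUnif k) (fun y => f y + g y) x =
      transition v (muUnif k) f x + transition v (muUnif k) g x := by
  simp only [transition_eq_lintegral_homog]
  rw [← lintegral_add_left]
  · refine lintegral_congr fun u => ?_
    simp only [homog, mul_add]
  · exact (measurable_homog hf).comp (measurable_krausAt_apply v measurable_id measurable_const)

/-- A Lyapunov function for the transition operator of a primitive channel. -/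
theorem exists_lyapunov (hv : IsKraus v Φ) (h1 : Φ 1 = 1) (hprim : IsPrimitive Φ) :
    ∃ V : PC 2 → ℝ≥0∞, Measurable V ∧ ∫⁻ x, V x ∂(nuUnif 2) ≠ ∞ ∧
      ∀ x, transition v (muUnif k) V x + 1 ≤
        V x + ENNReal.ofReal (2 * detAt Φ x ^ 2) * ∫⁻ y, V y ∂(nuUnif 2) := by
  obtain ⟨n, -, hn⟩ := hprim
  have hcomp : IsCompact (Metric.sphere (0 : Vec 2) 1) := isCompact_sphere 0 1
  have hne : (Metric.sphere (0 : Vec 2) 1).Nonempty := ⟨e₀ 2, by simp [e₀]⟩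
  obtain ⟨z₁, hz₁, hmin⟩ := hcomp.exists_isMinOn hne
    (f := fun z => ∑ j ∈ Finset.range n, meanDetSq Φ v j z)
    (continuous_finsetSum _ fun j _ => continuous_meanDetSq hv j).continuousOn
  obtain ⟨z₂, hz₂, hmax⟩ := hcomp.exists_isMaxOn hne (f := potential Φ v n)
    (by
      unfold potential
      exact (continuous_finsetSum _ fun j _ =>
        continuous_const.mul (continuous_meanDetSq hv j)).continuousOn)
  -- The minimum over the unit sphere, positive by primitivity: the uniform gain of the potential
  -- per step, up to the term with `j = 0`.
  set ε : ℝ := ∑ j ∈ Finset.range n, meanDetSq Φ v j z₁ with hε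
  have hε0 : 0 < ε := exists_meanDetSq_pos hv hn (by
    rintro rfl
    simp at hz₁)
  have hsph : ∀ x : PC 2, unitRep x ∈ Metric.sphere (0 : Vec 2) 1 := fun x => by
    simp [norm_unitRep]
  -- The margin `n + 1` above the maximum gives `V ≥ (n + 1) / ε`, so that `2 det² * ∫ V` pays for
  -- the term `j = 0` of weight `n + 1`.
  set C : ℝ := potential Φ v n z₂ + (n + 1) with hC
  have hC0 : 0 ≤ C := by
    have := potential_nonneg (Φ := Φ) (v := v) n z₂
    positivity
  have hWC : ∀ x : PC 2, potential Φ v n (unitRep x) + (n + 1) ≤ C := fun x => by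
    have : potential Φ v n (unitRep x) ≤ potential Φ v n z₂ := hmax (hsph x)
    linarith
  have hn0 : (0 : ℝ) ≤ n := Nat.cast_nonneg n
  have hWm : Measurable fun x : PC 2 => potential Φ v n (unitRep x) := by
    unfold potential
    exact Finset.measurable_sum _ fun j _ => (measurable_meanDetSq_unitRep hv j).const_mul _
  set V : PC 2 → ℝ≥0∞ := fun x => ENNReal.ofReal ((C - potential Φ v n (unitRep x)) / ε) with hV
  set W : PC 2 → ℝ≥0∞ := fun x => ENNReal.ofReal (potential Φ v n (unitRep x) / ε) with hW
  have hVm : Measurable V := ((hWm.const_sub C).div_const ε).ennreal_ofReal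
  have hVW : ∀ x, V x + W x = ENNReal.ofReal (C / ε) := fun x => by
    rw [hV, hW, ← ENNReal.ofReal_add]
    · congr 1; ring
    · exact div_nonneg (by linarith [hWC x]) hε0.le
    · exact div_nonneg (potential_nonneg n _) hε0.le
  refine ⟨V, hVm, ?_, fun x => ?_⟩
  · refine ne_top_of_le_ne_top (b := ENNReal.ofReal (C / ε)) ENNReal.ofReal_ne_top ?_
    calc ∫⁻ x, V x ∂(nuUnif 2) ≤ ∫⁻ _, ENNReal.ofReal (C / ε) ∂(nuUnif 2) :=
          lintegral_mono fun x => by rw [← hVW x]; exact le_self_add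
      _ = _ := by simp
  · have hVint : ENNReal.ofReal ((n + 1) / ε) ≤ ∫⁻ y, V y ∂(nuUnif 2) := by
      calc ENNReal.ofReal ((n + 1) / ε) = ∫⁻ _, ENNReal.ofReal ((n + 1) / ε) ∂(nuUnif 2) := by simp
        _ ≤ _ := lintegral_mono fun y => ENNReal.ofReal_le_ofReal (by
          gcongr
          linarith [hWC y])
    have hT : transition v (muUnif k) V x + transition v (muUnif k) W x =
        ENNReal.ofReal (C / ε) := by
      rw [← transition_add v hVm, funext hVW]
      exact transition_const hv h1 ENNReal.ofReal_ne_top x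
    have hTW := le_transition_potential (v := v) hv h1 n hε0 x
    set S : ℝ := ∑ j ∈ Finset.range n, ((n : ℝ) - j) * meanDetSq Φ v (j + 1) (unitRep x) with hS
    have hS0 : 0 ≤ S := Finset.sum_nonneg fun j hj => mul_nonneg (by
      have : (j : ℝ) ≤ n := by exact_mod_cast (Finset.mem_range.1 hj).le
      linarith) (meanDetSq_nonneg Φ v _ _)
    have hid := sum_meanDetSq_succ (Φ := Φ) (v := v) n (unitRep x)
    rw [← hS, Finset.sum_range_succ] at hid
    have hmin' : ε ≤ ∑ j ∈ Finset.range n, meanDetSq Φ v j (unitRep x) := hmin (hsph x)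
    have hp0 : meanDetSq Φ v 0 (unitRep x) = 2 * detAt Φ x ^ 2 := rfl
    have hkey : ENNReal.ofReal (potential Φ v n (unitRep x) / ε) + 1 ≤
        ENNReal.ofReal (S / ε) +
          ENNReal.ofReal (2 * detAt Φ x ^ 2) * ENNReal.ofReal ((n + 1) / ε) := by
      rw [← ENNReal.ofReal_one, ← ENNReal.ofReal_add (div_nonneg (potential_nonneg n _) hε0.le)
        zero_le_one, ← ENNReal.ofReal_mul (by positivity),
        ← ENNReal.ofReal_add (div_nonneg hS0 hε0.le) (by positivity)]
      refine ENNReal.ofReal_le_ofReal ?_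
      rw [← hp0, ← mul_div_assoc, ← add_div, div_add_one hε0.ne']
      refine div_le_div_of_nonneg_right ?_ hε0.le
      have := meanDetSq_nonneg Φ v n (unitRep x)
      linarith
    -- `V + W` is a constant, which the transition preserves. Adding the finite `W x` to both sides
    -- turns the lower bound on the transition of `W` into an upper bound for `V` without
    -- subtraction.
    have hWx : W x ≠ ∞ := ENNReal.ofReal_ne_top
    refine (ENNReal.add_le_add_iff_right hWx).1 ?_
    calc transition v (muUnif k) V x + 1 + W x
        = transition v (muUnif k) V x + (W x + 1) := by ring
      _ ≤ transition v (muUnif k) V x + (ENNReal.ofReal (S / ε) +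
          ENNReal.ofReal (2 * detAt Φ x ^ 2) * ENNReal.ofReal ((n + 1) / ε)) := by gcongr
      _ ≤ transition v (muUnif k) V x + (transition v (muUnif k) W x +
          ENNReal.ofReal (2 * detAt Φ x ^ 2) * ∫⁻ y, V y ∂(nuUnif 2)) := by gcongr
      _ = V x + W x + ENNReal.ofReal (2 * detAt Φ x ^ 2) * ∫⁻ y, V y ∂(nuUnif 2) := by
          rw [← add_assoc, hT, hVW]
      _ = _ := by ring

end Lyapunov

/-! ### Absolute continuity of invariant measures -/

section Invariant

variable {k : ℕ} [NeZero k] {Φ : Mat 2 →ₗ[ℂ] Mat 2} {v : Fin k → Mat 2}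

/-- If every vector were singular, all `meanDetSq` would vanish, against primitivity. -/
theorem ae_detAt_ne_zero_of_isPrimitive (hv : IsKraus v Φ) (hprim : IsPrimitive Φ) :
    ∀ᵐ x ∂(nuUnif 2), detAt Φ x ≠ 0 := by
  obtain ⟨n, -, hn⟩ := hprim
  by_cases h : ∃ z₀, (traceDual Φ (outer z₀)).det ≠ 0
  · obtain ⟨z₀, h₀⟩ := h
    exact ae_detAt_ne_zero hv h₀
  · push Not at h
    have h0 : ∀ j z, meanDetSq Φ v j z = 0 := by
      intro j
      induction j with
      | zero => intro z; simp [meanDetSq, h z]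
      | succ j ih => intro z; simp [meanDetSq, ih]
    have h1 := exists_meanDetSq_pos hv hn (z := e₀ 2) (by simp [e₀])
    simp [h0] at h1

theorem transition_indicator_le_one (hv : IsKraus v Φ) (h1 : Φ 1 = 1) (S : Set (PC 2)) (x : PC 2) :
    transition v (muUnif k) (S.indicator 1) x ≤ 1 := by
  rw [← transition_const hv h1 ENNReal.one_ne_top x]
  refine lintegral_mono fun u => ?_
  gcongr
  exact Set.indicator_le_self' (fun _ _ => zero_le) _

/-- A point with singular `Φ^*(|x⟩⟨x|)` jumps to a single point. -/
theorem exists_mem_traceDual_ketBra_eq (hv : IsKraus v Φ) {S : Set (PC 2)} {x : PC 2}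
    (hx : detAt Φ x = 0) (hS : transition v (muUnif k) (S.indicator 1) x ≠ 0) :
    ∃ y ∈ S, ∃ c : ℂ, traceDual Φ (ketBra x) = c • ketBra y := by
  rw [transition_eq_lintegral_homog] at hS
  obtain ⟨u, hu⟩ : ∃ u : U k, homog (S.indicator 1)
      (Matrix.toEuclideanLin (krausAt v u) (unitRep x)) ≠ 0 := by
    by_contra! h
    exact hS (by simp [h])
  set w := Matrix.toEuclideanLin (krausAt v u) (unitRep x) with hw
  rw [homog, mul_ne_zero_iff] at hu
  have hw0 : w ≠ 0 := by
    intro h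
    simp [h] at hu
  have hwS : proj w ∈ S := by
    by_contra hn
    exact hu.2 (Set.indicator_of_notMem hn _)
  have hdet : (traceDual Φ (outer (unitRep x))).det = 0 := by
    rw [← ketBra_eq_outer, det_eq_detAt hv, hx, Complex.ofReal_zero]
  obtain ⟨c, hc⟩ := traceDual_outer_eq_smul_outer hv hdet hw0
    (toEuclideanLin_krausAt_eq_sum v u (unitRep x))
  refine ⟨proj w, hwS, c * (‖w‖ : ℂ) ^ 2, ?_⟩
  have hn : (‖w‖ : ℂ) ≠ 0 := by simpa using hw0
  rw [ketBra_eq_outer x, hc, ketBra_proj hw0, smul_smul]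
  congr 1
  push_cast
  field_simp

/-- The set of points from which `B` is reached in `j` steps with positive probability. -/
noncomputable def reach (v : Fin k → Mat 2) (B : Set (PC 2)) : ℕ → Set (PC 2)
  | 0 => B
  | j + 1 => {x | transition v (muUnif k) ((reach v B j).indicator 1) x ≠ 0}

theorem measurableSet_reach (v : Fin k → Mat 2) {B : Set (PC 2)} (hB : MeasurableSet B) (j : ℕ) :
    MeasurableSet (reach v B j) := by
  induction j with
  | zero => exact hB
  | succ j ih =>
    exact measurable_transition v (measurable_one.indicator ih) (measurableSet_singleton 0).compl

/-- From a nonsingular point the jump has a density, so it cannot charge a null set. -/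
theorem detAt_eq_zero_of_mem_reach (hv : IsKraus v Φ) (h1 : Φ 1 = 1) {B : Set (PC 2)}
    (hB : MeasurableSet B) {j : ℕ} (h0 : nuUnif 2 (reach v B j) = 0) {x : PC 2}
    (hx : x ∈ reach v B (j + 1)) : detAt Φ x = 0 := by
  by_contra h
  refine hx ?_
  have hm := measurableSet_reach v hB j
  rw [transition_eq_lintegral_gapKernel hv h1 (measurable_one.indicator hm) h]
  refine lintegral_eq_zero_of_ae_eq_zero ?_
  filter_upwards [measure_eq_zero_iff_ae_notMem.1 h0] with y hy
  simp [hy]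

theorem nuUnif_reach (hv : IsKraus v Φ) (h1 : Φ 1 = 1) (hprim : IsPrimitive Φ) {B : Set (PC 2)}
    (hB : MeasurableSet B) (h0 : nuUnif 2 B = 0) (j : ℕ) : nuUnif 2 (reach v B j) = 0 := by
  induction j with
  | zero => exact h0
  | succ j ih =>
    refine measure_mono_null (fun x hx => ?_) (ae_iff.1 (ae_detAt_ne_zero_of_isPrimitive hv hprim))
    exact not_not.2 (detAt_eq_zero_of_mem_reach hv h1 hB ih hx)

theorem exists_iterate_ketBra_eq_of_mem_reach (hv : IsKraus v Φ) (h1 : Φ 1 = 1)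
    (hprim : IsPrimitive Φ) {B : Set (PC 2)} (hB : MeasurableSet B) (h0 : nuUnif 2 B = 0) (j : ℕ)
    {x : PC 2} (hx : x ∈ reach v B j) :
    ∃ (c : ℂ) (w : Vec 2), (traceDual Φ)^[j] (ketBra x) = c • outer w := by
  induction j generalizing x with
  | zero => exact ⟨1, unitRep x, by rw [one_smul]; rfl⟩
  | succ j ih =>
    have hd := detAt_eq_zero_of_mem_reach hv h1 hB (nuUnif_reach hv h1 hprim hB h0 j) hx
    obtain ⟨y, hy, c, hc⟩ := exists_mem_traceDual_ketBra_eq hv hd hx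
    obtain ⟨c', w, hw⟩ := ih hy
    exact ⟨c * c', w, by
      rw [Function.iterate_succ_apply, hc, traceDual_iterate_smul, hw, smul_smul]⟩

/-- By invariance the left side is the integral of a probability that vanishes off `reach v B (j +
1)`. -/
theorem measure_reach_le_succ (hv : IsKraus v Φ) (h1 : Φ 1 = 1) {ν : Measure (PC 2)}
    (hν : IsInvariantMeasure v (muUnif k) ν) {B : Set (PC 2)} (hB : MeasurableSet B) (j : ℕ) :
    ν (reach v B j) ≤ ν (reach v B (j + 1)) := by
  rw [← hν _ (measurableSet_reach v hB j),
    ← lintegral_indicator_one (measurableSet_reach v hB (j + 1))]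
  refine lintegral_mono fun x => ?_
  by_cases hx : x ∈ reach v B (j + 1)
  · rw [Set.indicator_of_mem hx]
    exact transition_indicator_le_one hv h1 _ x
  · rw [Set.indicator_of_notMem hx]
    exact (not_not.1 hx : transition v (muUnif k) ((reach v B j).indicator 1) x = 0).le

/-- Invariant measures of a primitive channel are absolutely continuous. -/
theorem IsInvariantMeasure.absolutelyContinuous (hv : IsKraus v Φ) (h1 : Φ 1 = 1)
    (hprim : IsPrimitive Φ) {ν : Measure (PC 2)} (hν : IsInvariantMeasure v (muUnif k) ν) :
    ν ≪ nuUnif 2 := by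
  refine Measure.AbsolutelyContinuous.mk fun B hB h0 => ?_
  obtain ⟨n, -, hn⟩ := id hprim
  have hle : ∀ j, ν B ≤ ν (reach v B j) := by
    intro j
    induction j with
    | zero => exact le_rfl
    | succ j ih => exact ih.trans (measure_reach_le_succ hv h1 hν hB j)
  have hempty : reach v B n = ∅ := by
    refine Set.eq_empty_of_forall_notMem fun x hx => ?_
    obtain ⟨c, w, hw⟩ := exists_iterate_ketBra_eq_of_mem_reach hv h1 hprim hB h0 n hx
    exact traceDual_iterate_ne_smul_outer hn (unitRep_ne_zero x) c w hw
  have := hle n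
  rw [hempty, measure_empty] at this
  exact le_antisymm this zero_le

/-- Singular points carry no mass here, so the invariance of a measure with density `f` means that
`kerOp` fixes `f` almost everywhere. -/
theorem lintegral_transition_withDensity (hv : IsKraus v Φ) (h1 : Φ 1 = 1)
    (hprim : IsPrimitive Φ) {f : PC 2 → ℝ≥0∞} (hf : Measurable f) {A : Set (PC 2)}
    (hA : MeasurableSet A) :
    ∫⁻ x, transition v (muUnif k) (A.indicator 1) x ∂((nuUnif 2).withDensity f) =
      ∫⁻ y in A, kerOp (nuUnif 2) (fun x' x => ENNReal.ofReal (gapKernel Φ x' x)) f y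
        ∂(nuUnif 2) := by
  have hK := measurable_gapKernel hv h1
  have hAm : Measurable (A.indicator (1 : PC 2 → ℝ≥0∞)) := measurable_one.indicator hA
  rw [lintegral_withDensity_eq_lintegral_mul _ hf (measurable_transition v hAm),
    ← lintegral_indicator hA]
  have h2 : ∀ y, A.indicator (kerOp (nuUnif 2)
      (fun x' x => ENNReal.ofReal (gapKernel Φ x' x)) f) y =
      kerOp (nuUnif 2) (fun x' x => ENNReal.ofReal (gapKernel Φ x' x)) f y *
        A.indicator (1 : PC 2 → ℝ≥0∞) y := fun y => by
    by_cases hy : y ∈ A <;> simp [hy]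
  rw [lintegral_congr h2, lintegral_kerOp_mul hK hf hAm]
  refine lintegral_congr_ae ?_
  filter_upwards [ae_detAt_ne_zero_of_isPrimitive hv hprim] with x hx
  rw [Pi.mul_apply, transition_eq_lintegral_gapKernel hv h1 hAm hx]

end Invariant

end QTraj

/-! ### The main theorem -/

open QTraj in
theorem proposition6p1
    (Φ : QTraj.Mat 2 →ₗ[ℂ] QTraj.Mat 2) (hΦ : QTraj.IsQuantumChannel Φ)
    (hprim : QTraj.IsPrimitive Φ)
    (k : ℕ) [NeZero k] (v : Fin k → QTraj.Mat 2) (hv : QTraj.IsKraus v Φ) :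
    ∃ νinv : Measure (QTraj.PC 2),
      -- `νinv` is the unique invariant probability measure
      IsProbabilityMeasure νinv ∧
      QTraj.IsInvariantMeasure v (QTraj.muUnif k) νinv ∧
      (∀ ν : Measure (QTraj.PC 2), IsProbabilityMeasure ν →
        QTraj.IsInvariantMeasure v (QTraj.muUnif k) ν → ν = νinv) ∧
      -- it is equivalent to the uniform measure
      νinv ≪ QTraj.nuUnif 2 ∧ QTraj.nuUnif 2 ≪ νinv ∧
      -- the inverse matrix in the kernel exists almost everywhere
      (∀ᵐ x' ∂(QTraj.nuUnif 2),
        IsUnit (QTraj.traceDual Φ (QTraj.ketBra x')).det) ∧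
      -- the density solves the integral equation
      (∀ᵐ x ∂(QTraj.nuUnif 2),
        νinv.rnDeriv (QTraj.nuUnif 2) x =
          ∫⁻ x', ENNReal.ofReal (QTraj.gapKernel Φ x' x) *
            νinv.rnDeriv (QTraj.nuUnif 2) x' ∂(QTraj.nuUnif 2)) := by
  have h1 := hΦ.map_one
  set K : PC 2 → PC 2 → ℝ≥0∞ := fun x' x => ENNReal.ofReal (gapKernel Φ x' x) with hKdef
  have hK : Measurable (Function.uncurry K) := measurable_gapKernel hv h1
  have hZ := ae_detAt_ne_zero_of_isPrimitive hv hprim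
  have hK1 : ∀ᵐ x ∂(nuUnif 2), ∫⁻ y, K x y ∂(nuUnif 2) = 1 := by
    filter_upwards [hZ] with x hx
    have h := transition_eq_lintegral_gapKernel hv h1 (f := fun _ => 1) measurable_const hx
    rw [transition_const hv h1 ENNReal.one_ne_top] at h
    simpa using h.symm
  have hsK : ∀ᵐ x ∂(nuUnif 2), ∀ y, ENNReal.ofReal (2 * detAt Φ x ^ 2) ≤ K x y := by
    filter_upwards [hZ] with x hx y
    exact ENNReal.ofReal_le_ofReal (two_mul_detAt_sq_le_gapKernel hv h1 hx y)
  have hpos : ∀ᵐ x ∂(nuUnif 2), ∀ y, K x y ≠ 0 := by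
    filter_upwards [hZ, hsK] with x hx h y h0
    have := h y
    rw [h0, nonpos_iff_eq_zero, ENNReal.ofReal_eq_zero] at this
    have h2 : 0 < detAt Φ x ^ 2 := by positivity
    linarith
  obtain ⟨V, hVm, hVf, hV⟩ := exists_lyapunov hv h1 hprim
  obtain ⟨g, hgm, hg, hgf, hg0⟩ := exists_kerOp_eq_self hK hK1
    (((measurable_detAt hv).pow_const 2).const_mul 2).ennreal_ofReal
    (fun _ => ENNReal.ofReal_ne_top) hsK hVm hVf (by
      filter_upwards [hZ] with x hx
      rw [← transition_eq_lintegral_gapKernel hv h1 hVm hx]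
      exact hV x)
  set c : ℝ≥0∞ := (∫⁻ x, g x ∂(nuUnif 2))⁻¹ with hc
  set f : PC 2 → ℝ≥0∞ := fun x => c * g x with hf
  have hfm : Measurable f := hgm.const_mul c
  have hfi : ∫⁻ x, f x ∂(nuUnif 2) = 1 := by
    rw [hf, lintegral_const_mul _ hgm, hc, ENNReal.inv_mul_cancel hg0 hgf]
  have hfK : kerOp (nuUnif 2) K f = f := by
    funext y
    have h2 : ∀ x, K x y * f x = c * (K x y * g x) := fun x => by rw [hf]; ring
    rw [kerOp, lintegral_congr h2, lintegral_const_mul _ (measurable_mul_right hK hgm y)]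
    change c * kerOp (nuUnif 2) K g y = _
    rw [hg]
  -- `f` is a fixed point at every `y`, so the positivity improving kernel makes it nonzero
  -- everywhere; this gives `nuUnif 2 ≪ νinv`.
  have hf0 : ∀ y, f y ≠ 0 := fun y => by
    rw [← hfK]
    exact kerOp_ne_zero hK hpos hfm (by rw [hfi]; exact one_ne_zero) y
  have hrn : ((nuUnif 2).withDensity f).rnDeriv (nuUnif 2) =ᵐ[nuUnif 2] f :=
    Measure.rnDeriv_withDensity _ hfm
  refine ⟨(nuUnif 2).withDensity f, ⟨?_⟩, fun A hA => ?_, fun ν hνp hν => ?_,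
    withDensity_absolutelyContinuous _ _,
    withDensity_absolutelyContinuous' hfm.aemeasurable (ae_of_all _ hf0), ?_, ?_⟩
  · rw [withDensity_apply _ MeasurableSet.univ, Measure.restrict_univ, hfi]
  · rw [lintegral_transition_withDensity hv h1 hprim hfm hA, hfK, withDensity_apply _ hA]
  · have hac := hν.absolutelyContinuous hv h1 hprim
    set φ := ν.rnDeriv (nuUnif 2) with hφ
    have hφm : Measurable φ := Measure.measurable_rnDeriv _ _
    have hνφ : (nuUnif 2).withDensity φ = ν := Measure.withDensity_rnDeriv_eq _ _ hac
    have hφi : ∫⁻ x, φ x ∂(nuUnif 2) = 1 := by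
      rw [hφ, Measure.lintegral_rnDeriv hac, measure_univ]
    have hφK : kerOp (nuUnif 2) K φ =ᵐ[nuUnif 2] φ := by
      refine ae_eq_of_forall_setLIntegral_eq_of_sigmaFinite (measurable_kerOp hK hφm) hφm
        fun A hA _ => ?_
      rw [← lintegral_transition_withDensity hv h1 hprim hφm hA, hνφ, hν A hA, ← hνφ,
        withDensity_apply _ hA]
    rw [← hνφ]
    exact withDensity_congr_ae
      (ae_eq_of_kerOp_ae_eq hK hK1 hpos hφm hfm hφi hfi hφK (ae_of_all _ fun y => by rw [hfK]))
  · filter_upwards [hZ] with x hx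
    rw [isUnit_iff_ne_zero, det_eq_detAt hv]
    exact_mod_cast hx
  · filter_upwards [hrn] with x hx
    rw [hx]
    -- The Radon–Nikodym derivative agrees with `f` only almost everywhere; the equation holds
    -- pointwise for `f` and is transferred on both sides.
    conv_lhs => rw [← hfK]
    refine lintegral_congr_ae ?_
    filter_upwards [hrn] with x' hx'
    rw [hx']
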